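/- Let $p$ be a prime, $N\ge 1$ an integer and $s>-1$ a real number. Write $(\alpha;q)_n=\prod_{j=0}^{n-1}(1-\alpha q^j)$, $(\alpha;q)_0=1$. Every $\mathbf Z\in \mathrm{Mat}(N,\mathbb Q_p)$ can be written as $\mathbf Z=\mathbf B\,\mathrm{diag}(p^{-k_1},\dots,p^{-k_N})\,\mathbf C$ with $\mathbf B,\mathbf C\in \mathrm{GL}(N,\mathbb Z_p)$ and $k_1\ge\dots\ge k_N$ in $\mathbb Z\cup\{-\infty\}$ (where $p^{-(-\infty)}=0$), the tuple $(k_1,\dots,k_N)$ is unique, and the map $\mathsf{Sing}_N(\mathbf Z)=(k_1,\dots,k_N)$ is Borel measurable. Let $\mathsf{vol}$ be the Haar measure on $\mathrm{Mat}(N,\mathbb Q_p)$ with $\mathsf{vol}(\mathrm{Mat}(N,\mathbb Z_p))=1$, let $\gamma(\mathbf Z)=\prod_{k_j>0}p^{k_j}$, where $(k_1,\dots,k_N)=\mathsf{Sing}_N(\mathbf Z)$, let $$d\mathsf M_N^{(s)}(\mathbf Z)=\frac{(p^{-1-s};p^{-1})_N^2}{(p^{-1-s};p^{-1})_{2N}}\,\gamma(\mathbf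 Z)^{-s-2N}\,d\mathsf{vol}(\mathbf Z)$$ be the $p$-adic Hua measure, and let $\mathsf m_N^{(s)}=(\mathsf{Sing}_N)_*\mathsf M_N^{(s)}$. Then, for all integers $k_1\ge\dots\ge k_N$, with $l_i=\#\{j:k_j=i\}$, $$\mathsf m_N^{(s)}(k_1,\dots,k_N)=\frac{(p^{-1-s};p^{-1})_N^2}{(p^{-1-s};p^{-1})_{2N}}\;p^{-(s+2N)\sum_{k_j>0}k_j-\sum_{j=1}^N(2j-2N-1)k_j}\;\frac{(p^{-1};p^{-1})_N^2}{\prod_{i}(p^{-1};p^{-1})_{l_i}},$$ and, purely in terms of the multiplicities $l_i$, $$\mathsf m_N^{(s)}(k_1,\dots,k_N)=\frac{(p^{-1-s};p^{-1})_N^2\,(p^{-1};p^{-1})_N^2}{(p^{-1-s};p^{-1})_{2N}}\;p^{-\left[s\sum_{j\ge 0}j\,l_j+\sum_{i\ge 1}\left(\sum_{j\ge i}l_j\right)^2+\sum_{i\ge 1}\left(\sum_{j\le -i}l_j\right)^2\right]}\;\frac{1}{\prod_{i}(p^{-1};p^{-1})_{l_i}}.$$ Moreover, $\mathsf m_N^{(s)}$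 gives mass $0$ to the set of tuples with some $k_j=-\infty$. -/

import Mathlib

open MeasureTheory
open scoped BigOperators

noncomputable section

namespace PadicHua

/-- The finite `q`-Pochhammer symbol `(a; q)_n = ∏_{j = 0}^{n - 1} (1 - a q ^ j)`. -/
def qPochhammer (a q : ℝ) (n : ℕ) : ℝ := ∏ j ∈ Finset.range n, (1 - a * q ^ j)

/-- The space `Δ_N` of non-increasing `N`-tuples in `ℤ ∪ {-∞}`; the value `⊥` stands for `-∞`,
and the index `j : Fin N` stands for the position `j + 1`. -/
def Delta (N : ℕ) : Type := {k : Fin N → WithBot ℤ // Antitone k}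

/-- `Δ_N` is a countable Hausdorff space, so all of its subsets are Borel sets. -/
instance (N : ℕ) : MeasurableSpace (Delta N) := ⊤

/-- The element of `Δ_N` given by a non-increasing tuple of integers. -/
def Delta.ofInt {N : ℕ} (k : Fin N → ℤ) (hk : Antitone k) : Delta N :=
  ⟨fun j => (k j : WithBot ℤ), fun _ _ h => WithBot.coe_le_coe.mpr (hk h)⟩

/-- The element `(-∞, …, -∞)` of `Δ_N`. -/
def Delta.negInfty (N : ℕ) : Delta N := ⟨fun _ => ⊥, fun _ _ _ => le_rfl⟩

/-- The multiplicity `l_i(k) = #{j : k_j = i}`. -/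
def Delta.mult {N : ℕ} (k : Delta N) (i : WithBot ℤ) : ℕ :=
  (Finset.univ.filter fun j => k.1 j = i).card

variable (p : ℕ) [Fact p.Prime]

/-- The `p`-adic number `p ^ (-k)` for `k ∈ ℤ ∪ {-∞}`, with `p ^ (-(-∞)) = p ^ ∞ = 0`. -/
def primePowNeg : WithBot ℤ → ℚ_[p]
  | ⊥ => 0
  | (k : ℤ) => (p : ℚ_[p]) ^ (-k)

/-- `k` is a tuple of singular numbers of `Z`:
`Z = B * diag(p ^ (-k_1), …, p ^ (-k_N)) * C` for some `B, C ∈ GL(N, ℤ_p)`. -/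
def IsSingularNumbers {N : ℕ} (Z : Matrix (Fin N) (Fin N) ℚ_[p]) (k : Delta N) : Prop :=
  ∃ B C : Matrix.GeneralLinearGroup (Fin N) ℤ_[p],
    Z = (B : Matrix (Fin N) (Fin N) ℤ_[p]).map (fun x => (x : ℚ_[p])) *
      Matrix.diagonal (fun j => primePowNeg p (k.1 j)) *
      (C : Matrix (Fin N) (Fin N) ℤ_[p]).map (fun x => (x : ℚ_[p]))

open Classical in
/-- The map `Sing_N` that sends a matrix to its singular numbers. These exist and are unique for
every matrix, so the default value in the `else` branch is never used. -/
def sing {N : ℕ} (Z : Matrix (Fin N) (Fin N) ℚ_[p]) : Delta N :=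
  if h : ∃ k, IsSingularNumbers p Z k then h.choose else Delta.negInfty N

/-- `γ(Z) = ∏_{k_j > 0} p ^ k_j`, where `k` is the tuple of singular numbers of `Z`. -/
def gammaFn {N : ℕ} (Z : Matrix (Fin N) (Fin N) ℚ_[p]) : ℝ :=
  ∏ j with 0 < (sing p Z).1 j, (p : ℝ) ^ (((sing p Z).1 j).unbotD 0)

/-- Matrices over `ℚ_p` carry the Borel `σ`-algebra of the product topology. -/
instance (N : ℕ) : MeasurableSpace (Matrix (Fin N) (Fin N) ℚ_[p]) := borel _

instance (N : ℕ) : BorelSpace (Matrix (Fin N) (Fin N) ℚ_[p]) := ⟨rfl⟩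

/-- The compact open subset `Mat(N, ℤ_p)` of `Mat(N, ℚ_p)`. -/
def integralMatrices (N : ℕ) :
    TopologicalSpace.PositiveCompacts (Matrix (Fin N) (Fin N) ℚ_[p]) where
  carrier := {Z | ∀ i j, ‖Z i j‖ ≤ 1}
  isCompact' := by
    have h : IsCompact (Set.univ.pi fun _ : Fin N => Set.univ.pi fun _ : Fin N =>
        Metric.closedBall (0 : ℚ_[p]) 1) :=
      isCompact_univ_pi fun _ => isCompact_univ_pi fun _ => isCompact_closedBall _ _
    have e : {Z : Matrix (Fin N) (Fin N) ℚ_[p] | ∀ i j, ‖Z i j‖ ≤ 1} =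
        Set.univ.pi fun _ : Fin N => Set.univ.pi fun _ : Fin N =>
          Metric.closedBall (0 : ℚ_[p]) 1 := by
      apply Set.ext
      intro Z
      exact ⟨fun hZ i _ j _ => mem_closedBall_zero_iff.2 (hZ i j),
        fun hZ i j => mem_closedBall_zero_iff.1 (hZ i trivial j trivial)⟩
    exact e ▸ h
  interior_nonempty' := by
    have h : IsOpen (Set.univ.pi fun _ : Fin N => Set.univ.pi fun _ : Fin N =>
        Metric.ball (0 : ℚ_[p]) 1) :=
      isOpen_set_pi Set.finite_univ fun _ _ => isOpen_set_pi Set.finite_univ fun _ _ =>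
        Metric.isOpen_ball
    refine ⟨0, mem_interior.2 ⟨_, ?_, h, ?_⟩⟩
    · intro Z hZ i j
      have := hZ i trivial j trivial
      rw [mem_ball_zero_iff] at this
      exact this.le
    · intro i _ j _
      simp

/-- The Haar measure on `Mat(N, ℚ_p)`, normalized by `vol(Mat(N, ℤ_p)) = 1`. -/
def vol (N : ℕ) : Measure (Matrix (Fin N) (Fin N) ℚ_[p]) :=
  Measure.addHaarMeasure (integralMatrices p N)

/-- The normalization constant `(p^{-1-s}; p^{-1})_N ^ 2 / (p^{-1-s}; p^{-1})_{2N}`. -/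
def huaConst (N : ℕ) (s : ℝ) : ℝ :=
  qPochhammer ((p : ℝ) ^ (-1 - s)) (p : ℝ)⁻¹ N ^ 2 /
    qPochhammer ((p : ℝ) ^ (-1 - s)) (p : ℝ)⁻¹ (2 * N)

/-- The `p`-adic Hua measure `M_N^{(s)}`, with density
`(p^{-1-s}; p^{-1})_N ^ 2 / (p^{-1-s}; p^{-1})_{2N} * γ(Z) ^ (-s - 2N)` with respect to `vol`. -/
def huaMeasure (N : ℕ) (s : ℝ) : Measure (Matrix (Fin N) (Fin N) ℚ_[p]) :=
  (vol p N).withDensity fun Z =>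
    ENNReal.ofReal (huaConst p N s * gammaFn p Z ^ (-s - 2 * (N : ℝ)))

/-- The law `m_N^{(s)}` of the singular numbers under `M_N^{(s)}`. -/
def singularLaw (N : ℕ) (s : ℝ) : Measure (Delta N) := (huaMeasure p N s).map (sing p)

end PadicHua

end

noncomputable section

namespace PadicHua

/-! The fibre of `sing` over a finite tuple `k` is the double coset `G D G`, where `G` is the image
of `GL(N, ℤ_p)` and `D = diag(p ^ (-k_j))`. The density of the Hua measure is constant on it, so the
mass of `k` is that constant times the volume of the double coset, and the heart of the matter is
`vol_orbit_diagMat`.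

Let `H = G ∩ D G D⁻¹` (`conjInter`). Then `G D G` is the disjoint union of the sets `g D G`, and `G`
that of the sets `g H`, both over `g ∈ G / H`. Multiplication by `g` preserves volume, hence `vol(G
D G) vol(H) = vol(D G) vol(G)` (`vol_orbit_mul`). Here `vol(G)` is the proportion of invertible
matrices over `ZMod p`, and `D` scales volume by `p ^ (N ∑ k_j)`. The group `H` consists of integral
matrices with entry `(i, j)` multiplied by `p ^ max(0, k_j - k_i)`, subject to the diagonal blocks
on the level sets of `k` being invertible mod `p` (`image_conjInter_diagMat`). These blocks produce
the factors indexed by the multiplicities, and the powers of `p` combine to `∑ max(k_i, k_j)` over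
all pairs. For a non-increasing tuple this sum is linear in `k`; the formula in the multiplicities
comes from an identity for each pair (`exponent_eq`).

Singular numbers exist by elimination with a pivot of maximal norm. They are unique because an
element of `GL(N, ℤ_p)` has no large block vanishing mod `p` (`norm_det_lt_one_of_block`). Fibres of
`sing` are compact and the target is countable, so `sing` is measurable. An entry `-∞` forces
determinant zero, and singular matrices are null (`vol_det_eq_zero`). -/

variable {p : ℕ} [Fact p.Prime] {N : ℕ}

/-! ### Equivalence of matrices under `GL(N, ℤ_p)` -/

/-- The matrix over `ℚ_p` with the same entries as a matrix over `ℤ_p`. -/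
def toQp (A : Matrix (Fin N) (Fin N) ℤ_[p]) : Matrix (Fin N) (Fin N) ℚ_[p] :=
  A.map PadicInt.Coe.ringHom

@[simp] lemma toQp_apply (A : Matrix (Fin N) (Fin N) ℤ_[p]) (i j : Fin N) :
    toQp A i j = (A i j : ℚ_[p]) := rfl

lemma toQp_mul (A B : Matrix (Fin N) (Fin N) ℤ_[p]) : toQp (A * B) = toQp A * toQp B :=
  Matrix.map_mul

@[simp] lemma toQp_one : toQp (1 : Matrix (Fin N) (Fin N) ℤ_[p]) = 1 :=
  map_one PadicInt.Coe.ringHom.mapMatrix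

lemma det_toQp (A : Matrix (Fin N) (Fin N) ℤ_[p]) : (toQp A).det = (A.det : ℚ_[p]) :=
  (RingHom.map_det PadicInt.Coe.ringHom A).symm

lemma toQp_injective : Function.Injective (toQp : Matrix (Fin N) (Fin N) ℤ_[p] → _) := by
  intro A B h
  ext i j
  exact PadicInt.ext (congrFun (congrFun h i) j)

/-- The inclusion of `GL(N, ℤ_p)` into `Mat(N, ℚ_p)`. -/
def glQp (g : GL (Fin N) ℤ_[p]) : Matrix (Fin N) (Fin N) ℚ_[p] := toQp g.1

@[simp] lemma glQp_mul (g h : GL (Fin N) ℤ_[p]) : glQp (g * h) = glQp g * glQp h := toQp_mul _ _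

@[simp] lemma glQp_one : glQp (1 : GL (Fin N) ℤ_[p]) = 1 := toQp_one

@[simp] lemma glQp_inv_mul (g : GL (Fin N) ℤ_[p]) : glQp g⁻¹ * glQp g = 1 := by
  rw [← glQp_mul, inv_mul_cancel, glQp_one]

@[simp] lemma glQp_mul_inv (g : GL (Fin N) ℤ_[p]) : glQp g * glQp g⁻¹ = 1 := by
  rw [← glQp_mul, mul_inv_cancel, glQp_one]

@[simp] lemma glQp_inv_mul_assoc (g : GL (Fin N) ℤ_[p]) (Z : Matrix (Fin N) (Fin N) ℚ_[p]) :
    glQp g⁻¹ * (glQp g * Z) = Z := by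
  rw [← mul_assoc, glQp_inv_mul, one_mul]

@[simp] lemma glQp_mul_inv_assoc (g : GL (Fin N) ℤ_[p]) (Z : Matrix (Fin N) (Fin N) ℚ_[p]) :
    glQp g * (glQp g⁻¹ * Z) = Z := by
  rw [← mul_assoc, glQp_mul_inv, one_mul]

/-- Two matrices over `ℚ_p` are equivalent if they differ by factors in `GL(N, ℤ_p)`. -/
def IntEquiv (Z W : Matrix (Fin N) (Fin N) ℚ_[p]) : Prop :=
  ∃ B C : GL (Fin N) ℤ_[p], Z = glQp B * W * glQp C

lemma IntEquiv.refl (Z : Matrix (Fin N) (Fin N) ℚ_[p]) : IntEquiv Z Z := ⟨1, 1, by simp⟩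

lemma IntEquiv.symm {Z W : Matrix (Fin N) (Fin N) ℚ_[p]} (h : IntEquiv Z W) : IntEquiv W Z := by
  obtain ⟨B, C, rfl⟩ := h
  exact ⟨B⁻¹, C⁻¹, by simp [mul_assoc]⟩

lemma IntEquiv.trans {Z W V : Matrix (Fin N) (Fin N) ℚ_[p]} (h : IntEquiv Z W)
    (h' : IntEquiv W V) : IntEquiv Z V := by
  obtain ⟨B, C, rfl⟩ := h
  obtain ⟨B', C', rfl⟩ := h'
  exact ⟨B * B', C' * C, by simp [mul_assoc]⟩

/-! ### Existence of singular numbers -/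

/-- A permutation matrix as an element of `GL(N, ℤ_p)`. -/
def permGL (σ : Equiv.Perm (Fin N)) : GL (Fin N) ℤ_[p] where
  val := σ.permMatrix ℤ_[p]
  inv := σ⁻¹.permMatrix ℤ_[p]
  val_inv := by rw [← Matrix.permMatrix_mul]; simp
  inv_val := by rw [← Matrix.permMatrix_mul]; simp

lemma glQp_permGL (σ : Equiv.Perm (Fin N)) :
    glQp (permGL σ : GL (Fin N) ℤ_[p]) = σ.permMatrix ℚ_[p] :=
  PEquiv.map_toMatrix _ _

lemma IntEquiv.submatrix (Z : Matrix (Fin N) (Fin N) ℚ_[p]) (σ τ : Equiv.Perm (Fin N)) :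
    IntEquiv (Z.submatrix σ τ) Z := by
  refine ⟨permGL σ, permGL τ⁻¹, ?_⟩
  rw [glQp_permGL, glQp_permGL, Equiv.Perm.permMatrix, Equiv.Perm.permMatrix,
    PEquiv.toMatrix_toPEquiv_mul, PEquiv.mul_toMatrix_toPEquiv]
  rfl

/-- The matrix `1 - u vᵀ` with `v ⬝ u = 0` as an element of `GL(N, ℤ_p)`. -/
def transvecGL (u v : Fin N → ℤ_[p]) (h : v ⬝ᵥ u = 0) : GL (Fin N) ℤ_[p] where
  val := 1 - Matrix.vecMulVec u v
  inv := 1 + Matrix.vecMulVec u v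
  val_inv := by simp [mul_add, sub_mul, Matrix.vecMulVec_mul_vecMulVec, h]
  inv_val := by simp [mul_sub, add_mul, Matrix.vecMulVec_mul_vecMulVec, h]

lemma glQp_transvecGL_apply (u v : Fin N → ℤ_[p]) (h : v ⬝ᵥ u = 0) (i j : Fin N) :
    glQp (transvecGL u v h) i j = (1 : Matrix (Fin N) (Fin N) ℚ_[p]) i j - u i * v j := by
  change ((((1 : Matrix (Fin N) (Fin N) ℤ_[p]) - Matrix.vecMulVec u v) i j : ℤ_[p]) : ℚ_[p]) = _
  simp only [Matrix.sub_apply, Matrix.one_apply, Matrix.vecMulVec_apply, PadicInt.coe_sub,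
    PadicInt.coe_mul]
  split_ifs <;> simp

/-- Elimination with a pivot of maximal norm in its row and column. -/
lemma intEquiv_pivot (W : Matrix (Fin N) (Fin N) ℚ_[p]) (a : Fin N) (h0 : W a a ≠ 0)
    (hc : ∀ i, ‖W i a‖ ≤ ‖W a a‖) (hr : ∀ j, ‖W a j‖ ≤ ‖W a a‖) :
    IntEquiv W (Matrix.of fun i j => if i = a ∧ j = a then W a a else
      W i j - W i a * W a j / W a a) := by
  -- Maximality of the pivot makes the elimination multipliers `p`-adic integers.
  have hdiv : ∀ x : ℚ_[p], ‖x‖ ≤ ‖W a a‖ → ‖x / W a a‖ ≤ 1 := fun x hx => by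
    rw [norm_div]; exact div_le_one_of_le₀ hx (norm_nonneg _)
  let u : Fin N → ℤ_[p] := fun i => if i = a then 0 else ⟨W i a / W a a, hdiv _ (hc i)⟩
  let v : Fin N → ℤ_[p] := fun j => if j = a then 0 else ⟨W a j / W a a, hdiv _ (hr j)⟩
  have hu : Pi.single a 1 ⬝ᵥ u = 0 := by simp [u]
  have hv : v ⬝ᵥ Pi.single a 1 = 0 := by simp [v]
  apply IntEquiv.symm
  refine ⟨transvecGL u (Pi.single a 1) hu, transvecGL (Pi.single a 1) v hv, ?_⟩
  have e1 : ∀ i j, (glQp (transvecGL u (Pi.single a 1) hu) * W) i j = W i j - u i * W a j := by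
    intro i j
    simp only [Matrix.mul_apply, glQp_transvecGL_apply, sub_mul, Finset.sum_sub_distrib]
    congr 1
    · simp [Matrix.one_apply]
    · rw [Finset.sum_eq_single a] <;> simp +contextual
  have e2 : ∀ (M : Matrix (Fin N) (Fin N) ℚ_[p]) i j,
      (M * glQp (transvecGL (Pi.single a 1) v hv)) i j = M i j - M i a * v j := by
    intro M i j
    simp only [Matrix.mul_apply, glQp_transvecGL_apply, mul_sub, Finset.sum_sub_distrib]
    congr 1
    · simp [Matrix.one_apply]
    · rw [Finset.sum_eq_single a] <;> simp +contextual
  ext i j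
  rw [e2, e1, e1, Matrix.of_apply]
  by_cases hi : i = a <;> by_cases hj : j = a <;> simp [u, v, hi, hj] <;> field_simp; ring

/-- Every matrix over `ℚ_p` is equivalent to a diagonal matrix. -/
lemma exists_intEquiv_diagonal (Z : Matrix (Fin N) (Fin N) ℚ_[p]) :
    ∃ d : Fin N → ℚ_[p], IntEquiv Z (Matrix.diagonal d) := by
  -- `S` indexes the block still to be diagonalized; each pivot removes one index from it.
  suffices H : ∀ (S : Finset (Fin N)) (W : Matrix (Fin N) (Fin N) ℚ_[p]),
      (∀ i j, i ≠ j → (i ∉ S ∨ j ∉ S) → W i j = 0) →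
      ∃ d : Fin N → ℚ_[p], IntEquiv W (Matrix.diagonal d) from
    H Finset.univ Z (by simp)
  intro S
  induction' hn : S.card with n ih generalizing S
  · intro W hW
    refine ⟨fun i => W i i, ?_⟩
    rw [Finset.card_eq_zero] at hn
    convert IntEquiv.refl W
    ext i j
    by_cases h : i = j
    · simp [h]
    · simp [h, hW i j h, hn]
  · intro W hW
    have hS : S.Nonempty := by rw [← Finset.card_pos]; omega
    obtain ⟨⟨a, b⟩, hab, hmax⟩ := (S ×ˢ S).exists_max_image (fun x => ‖W x.1 x.2‖)
      (hS.product hS)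
    rw [Finset.mem_product] at hab
    by_cases h0 : W a b = 0
    · refine ⟨fun i => W i i, ?_⟩
      convert IntEquiv.refl W
      ext i j
      by_cases h : i = j
      · simp [h]
      · rw [Matrix.diagonal_apply_ne _ h]
        by_cases hij : i ∈ S ∧ j ∈ S
        · have := hmax (i, j) (Finset.mem_product.2 hij)
          simp only [h0, norm_zero, norm_le_zero_iff] at this
          exact this.symm
        · exact (hW i j h (by tauto)).symm
    -- A column swap inside `S` moves the maximal entry to the diagonal position `(a, a)`.
    · set V := W.submatrix id (Equiv.swap a b) with hV
      have hVW : IntEquiv V W := IntEquiv.submatrix W 1 _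
      have hsw : ∀ j, j ∉ S → Equiv.swap a b j = j := fun j hj =>
        Equiv.swap_apply_of_ne_of_ne (fun h => hj (h ▸ hab.1)) (fun h => hj (h ▸ hab.2))
      have hsw' : ∀ j, j ∈ S → Equiv.swap a b j ∈ S := fun j hj => by
        rw [Equiv.swap_apply_def]; split_ifs
        exacts [hab.2, hab.1, hj]
      have hVz : ∀ i j, i ≠ j → (i ∉ S ∨ j ∉ S) → V i j = 0 := by
        intro i j hij h
        change W i (Equiv.swap a b j) = 0
        by_cases hj : j ∈ S
        · have hi : i ∉ S := by tauto
          exact hW _ _ (fun e => hi (e ▸ hsw' j hj)) (Or.inl hi)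
        · rw [hsw j hj]; exact hW _ _ hij h
      have hVm : ∀ i j, i ∈ S → j ∈ S → ‖V i j‖ ≤ ‖V a a‖ := by
        intro i j hi hj
        have := hmax (i, Equiv.swap a b j) (Finset.mem_product.2 ⟨hi, hsw' j hj⟩)
        simpa [hV] using this
      have hVa : V a a ≠ 0 := by simpa [hV] using h0
      have hpiv := intEquiv_pivot V a hVa
        (fun i => by
          by_cases hi : i ∈ S
          · exact hVm i a hi hab.1
          · rw [hVz i a (fun e => hi (e ▸ hab.1)) (Or.inl hi)]; simp)
        (fun j => by
          by_cases hj : j ∈ S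
          · exact hVm a j hab.1 hj
          · rw [hVz a j (fun e => hj (e ▸ hab.1)) (Or.inr hj)]; simp)
      obtain ⟨d, hd⟩ := ih (S.erase a) (by rw [Finset.card_erase_of_mem hab.1]; omega)
        (Matrix.of fun i j => if i = a ∧ j = a then V a a else V i j - V i a * V a j / V a a)
        (fun i j hij h => by
          rw [Matrix.of_apply, if_neg (fun h => hij (h.1.trans h.2.symm))]
          by_cases hi : i = a
          · subst hi; field_simp; ring
          by_cases hj : j = a
          · subst hj; field_simp; ring
          have h' : i ∉ S ∨ j ∉ S := by simpa [hi, hj] using h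
          rw [hVz i j hij h']
          rcases h' with h' | h'
          · rw [hVz i a hi (Or.inl h')]; simp
          · rw [hVz a j (Ne.symm hj) (Or.inr h')]; simp)
      exact ⟨d, hVW.symm.trans (hpiv.trans hd)⟩

lemma primePowNeg_bot : primePowNeg p ⊥ = 0 := rfl

lemma primePowNeg_coe (k : ℤ) : primePowNeg p (k : WithBot ℤ) = (p : ℚ_[p]) ^ (-k) := rfl

lemma norm_primePowNeg_coe (k : ℤ) : ‖primePowNeg p (k : WithBot ℤ)‖ = (p : ℝ) ^ k := by
  rw [primePowNeg_coe, Padic.norm_p_zpow, neg_neg]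

lemma norm_primePowNeg_strictMono : StrictMono fun k => ‖primePowNeg p k‖ := by
  have hp : 1 < (p : ℝ) := by exact_mod_cast (Fact.out : p.Prime).one_lt
  intro a b h
  induction b with
  | bot => simp at h
  | coe b =>
    simp only [norm_primePowNeg_coe]
    induction a with
    | bot => rw [primePowNeg_bot, norm_zero]; positivity
    | coe a =>
      rw [norm_primePowNeg_coe]
      exact zpow_lt_zpow_right₀ hp (WithBot.coe_lt_coe.1 h)

/-- Every `p`-adic number is a `p`-adic unit times a power of `p`, or zero. -/
lemma exists_eq_unit_mul_primePowNeg (x : ℚ_[p]) :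
    ∃ (k : WithBot ℤ) (u : ℤ_[p]ˣ), x = u * primePowNeg p k := by
  by_cases hx : x = 0
  · exact ⟨⊥, 1, by simp [hx, primePowNeg_bot]⟩
  · have hp : (p : ℚ_[p]) ≠ 0 := by exact_mod_cast (Fact.out : p.Prime).ne_zero
    refine ⟨((-x.valuation : ℤ) : WithBot ℤ),
      PadicInt.mkUnits (u := x * (p : ℚ_[p]) ^ (-x.valuation)) ?_, ?_⟩
    · rw [norm_mul, Padic.norm_eq_zpow_neg_valuation hx, Padic.norm_p_zpow, neg_neg,
        ← zpow_add₀ (by exact_mod_cast (Fact.out : p.Prime).ne_zero)]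
      simp
    · rw [primePowNeg_coe, PadicInt.mkUnits_eq, neg_neg, mul_assoc, ← zpow_add₀ hp]
      simp

/-- A diagonal matrix of units as an element of `GL(N, ℤ_p)`. -/
def diagGL (u : Fin N → ℤ_[p]ˣ) : GL (Fin N) ℤ_[p] where
  val := Matrix.diagonal fun i => (u i : ℤ_[p])
  inv := Matrix.diagonal fun i => ((u i)⁻¹ : ℤ_[p]ˣ)
  val_inv := by simp
  inv_val := by simp

lemma glQp_diagGL (u : Fin N → ℤ_[p]ˣ) :
    glQp (diagGL u) = Matrix.diagonal fun i => ((u i : ℤ_[p]) : ℚ_[p]) :=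
  Matrix.diagonal_map (map_zero PadicInt.Coe.ringHom)

/-- The matrix `diag(p ^ (-k_1), …, p ^ (-k_N))`. -/
def diagMat (p : ℕ) [Fact p.Prime] (k : Fin N → WithBot ℤ) : Matrix (Fin N) (Fin N) ℚ_[p] :=
  Matrix.diagonal fun j => primePowNeg p (k j)

lemma isSingularNumbers_iff (Z : Matrix (Fin N) (Fin N) ℚ_[p]) (k : Delta N) :
    IsSingularNumbers p Z k ↔ IntEquiv Z (diagMat p k.1) := Iff.rfl

theorem exists_isSingularNumbers (Z : Matrix (Fin N) (Fin N) ℚ_[p]) :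
    ∃ k, IsSingularNumbers p Z k := by
  obtain ⟨d, hd⟩ := exists_intEquiv_diagonal Z
  choose k u hk using fun i => exists_eq_unit_mul_primePowNeg (d i)
  have h1 : IntEquiv (Matrix.diagonal d) (diagMat p k) := by
    refine ⟨diagGL u, 1, ?_⟩
    rw [glQp_diagGL, glQp_one, mul_one, diagMat, Matrix.diagonal_mul_diagonal]
    congr 1
    ext i
    exact hk i
  -- Sorting in the order dual makes the tuple non-increasing.
  let σ := Tuple.sort (fun i => OrderDual.toDual (k i))
  have hσ := Tuple.monotone_sort (fun i => OrderDual.toDual (k i))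
  have hanti : Antitone (k ∘ σ) := fun i j hij => OrderDual.toDual_le_toDual.1 (hσ hij)
  refine ⟨⟨k ∘ σ, hanti⟩, (isSingularNumbers_iff Z _).2 (hd.trans (h1.trans (IntEquiv.symm ?_)))⟩
  convert IntEquiv.submatrix (diagMat p k) σ σ
  rw [diagMat, diagMat, Matrix.submatrix_diagonal_equiv]
  rfl

/-! ### Uniqueness of singular numbers -/

/-- A square matrix over `ℤ_p` that has a large enough block with entries of norm `< 1` is not
invertible. -/
lemma norm_det_lt_one_of_block (B : Matrix (Fin N) (Fin N) ℤ_[p]) (r : Fin N)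
    (h : ∀ i j, r ≤ i → j ≤ r → ‖B i j‖ < 1) : ‖B.det‖ < 1 := by
  rw [← PadicInt.mem_nonunits, ← IsLocalRing.mem_maximalIdeal, Matrix.det_apply]
  refine Ideal.sum_mem _ fun σ _ => ?_
  -- Pigeonhole: `σ` cannot inject `Iic r` into the smaller `Iio r`, so every term of the
  -- determinant has a factor in the block.
  obtain ⟨j, hj, hσ⟩ : ∃ j, j ≤ r ∧ r ≤ σ j := by
    by_contra! hcon
    have := Finset.card_le_card_of_injOn (s := Finset.Iic r) (t := Finset.Iio r) σ
      (fun j hj => by simpa using hcon j (by simpa using hj)) σ.injective.injOn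
    simp at this
  rw [Units.smul_def, zsmul_eq_mul]
  refine Ideal.mul_mem_left _ _ ?_
  rw [← Finset.mul_prod_erase _ _ (Finset.mem_univ j)]
  refine Ideal.mul_mem_right _ _ ?_
  rw [IsLocalRing.mem_maximalIdeal, PadicInt.mem_nonunits]
  exact h _ _ hσ hj

lemma norm_det_gl (g : GL (Fin N) ℤ_[p]) : ‖g.1.det‖ = 1 :=
  PadicInt.isUnit_iff.1 ((Matrix.isUnit_iff_isUnit_det _).1 g.isUnit)

/-- If `k'_r < k_r`, then for `j ≤ r ≤ i` the relation `B D_k = D_k' C⁻¹` bounds `‖B i j‖` by a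
ratio of norms below `1`, since `k'_i ≤ k'_r < k_r ≤ k_j`. Such a block rules out a unit
determinant. -/
lemma le_of_intEquiv_diagMat {k k' : Delta N} (h : IntEquiv (diagMat p k'.1) (diagMat p k.1)) :
    ∀ r, k.1 r ≤ k'.1 r := by
  intro r
  by_contra! hr
  obtain ⟨B, C, hBC⟩ := h
  have e : glQp B * diagMat p k.1 = diagMat p k'.1 * glQp C⁻¹ := by
    rw [hBC]; simp [mul_assoc]
  refine (norm_det_lt_one_of_block B.1 r fun i j hi hj => ?_).ne (norm_det_gl B)
  have e' := congrArg norm (congrFun (congrFun e i) j)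
  rw [diagMat, diagMat, Matrix.mul_diagonal, Matrix.diagonal_mul, norm_mul, norm_mul] at e'
  have hlt : ‖primePowNeg p (k'.1 i)‖ < ‖primePowNeg p (k.1 j)‖ :=
    norm_primePowNeg_strictMono (((k'.2 hi).trans_lt hr).trans_le (k.2 hj))
  have h1 : ‖glQp C⁻¹ i j‖ ≤ 1 := PadicInt.norm_le_one _
  have h2 : ‖glQp B i j‖ * ‖primePowNeg p (k.1 j)‖ < 1 * ‖primePowNeg p (k.1 j)‖ := by
    rw [e', one_mul]
    exact (mul_le_of_le_one_right (norm_nonneg _) h1).trans_lt hlt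
  exact lt_of_mul_lt_mul_right h2 (norm_nonneg _)

lemma IsSingularNumbers.unique {Z : Matrix (Fin N) (Fin N) ℚ_[p]} {k k' : Delta N}
    (h : IsSingularNumbers p Z k) (h' : IsSingularNumbers p Z k') : k = k' := by
  rw [isSingularNumbers_iff] at h h'
  exact Subtype.ext (funext fun r => le_antisymm (le_of_intEquiv_diagMat (h'.symm.trans h) r)
    (le_of_intEquiv_diagMat (h.symm.trans h') r))

lemma isSingularNumbers_sing (Z : Matrix (Fin N) (Fin N) ℚ_[p]) :
    IsSingularNumbers p Z (sing p Z) := by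
  have h := exists_isSingularNumbers Z
  rw [sing, dif_pos h]
  exact h.choose_spec

lemma sing_eq_iff {Z : Matrix (Fin N) (Fin N) ℚ_[p]} {k : Delta N} :
    sing p Z = k ↔ IsSingularNumbers p Z k :=
  ⟨fun h => h ▸ isSingularNumbers_sing Z, fun h => (isSingularNumbers_sing Z).unique h⟩

/-! ### Haar volume and reduction modulo `p` -/

instance : SecondCountableTopology (Matrix (Fin N) (Fin N) ℚ_[p]) :=
  inferInstanceAs (SecondCountableTopology (Fin N → Fin N → ℚ_[p]))

instance : LocallyCompactSpace (Matrix (Fin N) (Fin N) ℚ_[p]) :=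
  inferInstanceAs (LocallyCompactSpace (Fin N → Fin N → ℚ_[p]))

instance : CompactSpace (Matrix (Fin N) (Fin N) ℤ_[p]) :=
  inferInstanceAs (CompactSpace (Fin N → Fin N → ℤ_[p]))

instance : (vol p N).IsAddHaarMeasure := Measure.isAddHaarMeasure_addHaarMeasure _

lemma continuous_toQp : Continuous (toQp : Matrix (Fin N) (Fin N) ℤ_[p] → _) :=
  Continuous.matrix_map continuous_id continuous_subtype_val

lemma mem_integralMatrices {Z : Matrix (Fin N) (Fin N) ℚ_[p]} :
    Z ∈ (integralMatrices p N : Set (Matrix (Fin N) (Fin N) ℚ_[p])) ↔ ∀ i j, ‖Z i j‖ ≤ 1 := Iff.rfl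

lemma range_toQp : Set.range (toQp : Matrix (Fin N) (Fin N) ℤ_[p] → _) = integralMatrices p N := by
  ext Z
  rw [mem_integralMatrices]
  constructor
  · rintro ⟨A, rfl⟩ i j
    exact PadicInt.norm_le_one _
  · intro h
    exact ⟨Matrix.of fun i j => ⟨Z i j, h i j⟩, by ext i j; rfl⟩

lemma vol_integralMatrices : vol p N (integralMatrices p N) = 1 := Measure.addHaarMeasure_self

/-- The `p`-adic integral matrices whose reduction modulo `p` lies in `T`. -/
def residueSet (T : Set (Matrix (Fin N) (Fin N) (ZMod p))) : Set (Matrix (Fin N) (Fin N) ℚ_[p]) :=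
  toQp '' {A | A.map PadicInt.toZMod ∈ T}

lemma toZMod_eq_iff {x y : ℤ_[p]} :
    PadicInt.toZMod x = PadicInt.toZMod y ↔ ‖x - y‖ < 1 := by
  rw [← PadicInt.mem_nonunits, ← IsLocalRing.mem_maximalIdeal, ← PadicInt.ker_toZMod,
    RingHom.mem_ker, map_sub, sub_eq_zero]

lemma exists_map_toZMod (M : Matrix (Fin N) (Fin N) (ZMod p)) :
    ∃ A : Matrix (Fin N) (Fin N) ℤ_[p], A.map PadicInt.toZMod = M := by
  refine ⟨M.map fun m => (m.val : ℤ_[p]), ?_⟩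
  ext i j
  simp

lemma residueSet_singleton (A : Matrix (Fin N) (Fin N) ℤ_[p]) :
    residueSet {A.map PadicInt.toZMod} = {Z | ∀ i j, ‖Z i j - (A i j : ℚ_[p])‖ < 1} := by
  ext Z
  constructor
  · rintro ⟨B, hB, rfl⟩ i j
    have := congrFun (congrFun hB i) j
    exact toZMod_eq_iff.1 this
  · intro h
    have h1 : Z ∈ (integralMatrices p N : Set (Matrix (Fin N) (Fin N) ℚ_[p])) := fun i j => by
      have h2 := Padic.nonarchimedean (Z i j - (A i j : ℚ_[p])) (A i j : ℚ_[p])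
      rw [sub_add_cancel] at h2
      exact h2.trans (max_le (h i j).le (PadicInt.norm_le_one _))
    rw [← range_toQp] at h1
    obtain ⟨B, rfl⟩ := h1
    refine ⟨B, ?_, rfl⟩
    ext i j
    exact toZMod_eq_iff.2 (h i j)

lemma residueSet_eq_biUnion (T : Set (Matrix (Fin N) (Fin N) (ZMod p))) :
    residueSet T = ⋃ M ∈ T, residueSet {M} := by
  ext Z
  simp [residueSet]

lemma isOpen_residueSet (T : Set (Matrix (Fin N) (Fin N) (ZMod p))) : IsOpen (residueSet T) := by
  rw [residueSet_eq_biUnion]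
  refine isOpen_biUnion fun M _ => ?_
  obtain ⟨A, rfl⟩ := exists_map_toZMod M
  rw [residueSet_singleton]
  simp only [Set.ofPred_forall]
  refine isOpen_iInter_of_finite fun i => isOpen_iInter_of_finite fun j => ?_
  have : Continuous fun Z : Matrix (Fin N) (Fin N) ℚ_[p] => ‖Z i j - (A i j : ℚ_[p])‖ := by fun_prop
  exact isOpen_lt this continuous_const

lemma vol_residueSet_singleton (A : Matrix (Fin N) (Fin N) ℤ_[p]) :
    vol p N (residueSet {A.map PadicInt.toZMod}) = vol p N (residueSet {0}) := by
  have h0 : (0 : Matrix (Fin N) (Fin N) (ZMod p)) =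
      (0 : Matrix (Fin N) (Fin N) ℤ_[p]).map PadicInt.toZMod := by
    ext; simp
  rw [h0, residueSet_singleton, residueSet_singleton,
    ← measure_preimage_add (vol p N) (toQp A) {Z | ∀ i j, ‖Z i j - (A i j : ℚ_[p])‖ < 1}]
  congr 1
  ext Z
  simp

/-- The residue classes are disjoint open translates of one another, so volume counts them. -/
lemma vol_residueSet_eq_mul (T : Set (Matrix (Fin N) (Fin N) (ZMod p))) :
    vol p N (residueSet T) = Nat.card T * vol p N (residueSet {0}) := by
  rw [residueSet_eq_biUnion, measure_biUnion (Set.to_countable T)]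
  · have : ∀ M : T, vol p N (residueSet {M.1}) = vol p N (residueSet {0}) := fun M => by
      obtain ⟨A, hA⟩ := exists_map_toZMod M.1
      rw [← hA, vol_residueSet_singleton]
    simp only [this]
    rw [ENNReal.tsum_const, ENat.card_eq_coe_natCard]
    rfl
  · intro M _ M' _ h
    refine Set.disjoint_left.2 ?_
    rintro _ ⟨A, hA, rfl⟩ ⟨B, hB, h'⟩
    rw [toQp_injective h'] at hB
    exact h (hA.symm.trans hB)
  · exact fun M _ => (isOpen_residueSet _).measurableSet

lemma residueSet_univ : residueSet (Set.univ : Set (Matrix (Fin N) (Fin N) (ZMod p))) =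
    integralMatrices p N := by
  rw [← range_toQp, residueSet]
  simp

lemma card_matrix_zmod (ι : Type*) [Fintype ι] [DecidableEq ι] :
    Nat.card (Matrix ι ι (ZMod p)) = p ^ (Fintype.card ι * Fintype.card ι) := by
  rw [Nat.card_eq_fintype_card]
  change Fintype.card (ι → ι → ZMod p) = _
  simp [ZMod.card, pow_mul]

/-- The proportion of a set of matrices over `ZMod p` is the volume of its preimage. -/
lemma vol_residueSet (T : Set (Matrix (Fin N) (Fin N) (ZMod p))) :
    vol p N (residueSet T) = Nat.card T / (p : ENNReal) ^ (N * N) := by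
  have h := vol_residueSet_eq_mul (p := p) (N := N) Set.univ
  have hc : Nat.card (Set.univ : Set (Matrix (Fin N) (Fin N) (ZMod p))) = p ^ (N * N) := by
    rw [Nat.card_univ, card_matrix_zmod, Fintype.card_fin]
  rw [residueSet_univ, vol_integralMatrices, hc] at h
  push_cast at h
  rw [vol_residueSet_eq_mul, div_eq_mul_inv]
  congr 1
  exact ENNReal.eq_inv_of_mul_eq_one_left (by rw [mul_comm]; exact h.symm)

/-! ### Volume under linear changes of variables -/

/-- An automorphism of the additive group of matrices scales the volume by a constant. -/
lemma vol_image (φ : Matrix (Fin N) (Fin N) ℚ_[p] ≃ₜ+ Matrix (Fin N) (Fin N) ℚ_[p])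
    (S : Set (Matrix (Fin N) (Fin N) ℚ_[p])) :
    vol p N (φ '' S) = vol p N (φ '' integralMatrices p N) * vol p N S := by
  -- Thus `S ↦ vol (φ '' S)` is itself a Haar measure, and uniqueness gives the constant as its
  -- value on the integral matrices.
  have key : ∀ S, (vol p N).map φ.symm S = vol p N (φ '' S) := fun S => by
    have h1 := φ.symm.toHomeomorph.toMeasurableEquiv.map_apply (μ := vol p N) S
    have h2 : φ.symm.toHomeomorph.toMeasurableEquiv ⁻¹' S = φ '' S :=
      (φ.toEquiv.image_eq_preimage_symm S).symm
    rw [h2] at h1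
    exact h1
  have : ((vol p N).map φ.symm).IsAddHaarMeasure := φ.symm.isAddHaarMeasure_map _
  have h := Measure.addHaarMeasure_unique ((vol p N).map φ.symm) (integralMatrices p N)
  have h' := congrArg (fun μ => μ S) h
  simp only [Measure.smul_apply, smul_eq_mul] at h'
  rw [key, key] at h'
  exact h'

/-- Left multiplication by an invertible matrix. -/
def mulLeftEquiv (A B : Matrix (Fin N) (Fin N) ℚ_[p]) (h : A * B = 1) (h' : B * A = 1) :
    Matrix (Fin N) (Fin N) ℚ_[p] ≃ₜ+ Matrix (Fin N) (Fin N) ℚ_[p] where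
  toFun Z := A * Z
  invFun Z := B * Z
  left_inv Z := by simp [← mul_assoc, h']
  right_inv Z := by simp [← mul_assoc, h]
  map_add' Z W := mul_add _ _ _
  continuous_toFun := by fun_prop
  continuous_invFun := by fun_prop

lemma glQp_mul_mem_integralMatrices (g : GL (Fin N) ℤ_[p]) {Z : Matrix (Fin N) (Fin N) ℚ_[p]}
    (hZ : Z ∈ (integralMatrices p N : Set (Matrix (Fin N) (Fin N) ℚ_[p]))) :
    glQp g * Z ∈ (integralMatrices p N : Set (Matrix (Fin N) (Fin N) ℚ_[p])) := by
  rw [← range_toQp] at hZ ⊢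
  obtain ⟨A, rfl⟩ := hZ
  exact ⟨g.1 * A, toQp_mul _ _⟩

lemma vol_glQp_mul_image (g : GL (Fin N) ℤ_[p]) (S : Set (Matrix (Fin N) (Fin N) ℚ_[p])) :
    vol p N ((fun Z => glQp g * Z) '' S) = vol p N S := by
  have h := vol_image (mulLeftEquiv (glQp g) (glQp g⁻¹) (by simp) (by simp)) S
  have himg : mulLeftEquiv (glQp g) (glQp g⁻¹) (by simp) (by simp) '' integralMatrices p N =
      integralMatrices p N := by
    ext Z
    constructor
    · rintro ⟨W, hW, rfl⟩
      exact glQp_mul_mem_integralMatrices g hW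
    · intro hZ
      exact ⟨glQp g⁻¹ * Z, glQp_mul_mem_integralMatrices g⁻¹ hZ, glQp_mul_inv_assoc g Z⟩
  rw [himg, vol_integralMatrices, one_mul] at h
  exact h

/-- Multiplication of each matrix entry by its own power of `p`. -/
def scaleEquiv (a : Fin N × Fin N → ℤ) :
    Matrix (Fin N) (Fin N) ℚ_[p] ≃ₜ+ Matrix (Fin N) (Fin N) ℚ_[p] where
  toFun Z := Matrix.of fun i j => (p : ℚ_[p]) ^ a (i, j) * Z i j
  invFun Z := Matrix.of fun i j => (p : ℚ_[p]) ^ (-a (i, j)) * Z i j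
  left_inv Z := by
    have hp : (p : ℚ_[p]) ≠ 0 := by exact_mod_cast (Fact.out : p.Prime).ne_zero
    ext i j
    simp only [Matrix.of_apply, ← mul_assoc, ← zpow_add₀ hp]
    simp
  right_inv Z := by
    have hp : (p : ℚ_[p]) ≠ 0 := by exact_mod_cast (Fact.out : p.Prime).ne_zero
    ext i j
    simp only [Matrix.of_apply, ← mul_assoc, ← zpow_add₀ hp]
    simp
  map_add' Z W := by ext i j; simp [mul_add]
  continuous_toFun := continuous_matrix fun i j => by simp only [Matrix.of_apply]; fun_prop
  continuous_invFun := continuous_matrix fun i j => by simp only [Matrix.of_apply]; fun_prop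

lemma scaleEquiv_apply (a : Fin N × Fin N → ℤ) (Z : Matrix (Fin N) (Fin N) ℚ_[p]) (i j : Fin N) :
    scaleEquiv a Z i j = (p : ℚ_[p]) ^ a (i, j) * Z i j := rfl

lemma scaleEquiv_add (a b : Fin N × Fin N → ℤ) (Z : Matrix (Fin N) (Fin N) ℚ_[p]) :
    scaleEquiv (a + b) Z = scaleEquiv a (scaleEquiv b Z) := by
  have hp : (p : ℚ_[p]) ≠ 0 := by exact_mod_cast (Fact.out : p.Prime).ne_zero
  ext i j
  rw [scaleEquiv_apply, scaleEquiv_apply, scaleEquiv_apply, ← mul_assoc, Pi.add_apply,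
    zpow_add₀ hp]

lemma vol_scaleEquiv_add (a b : Fin N × Fin N → ℤ) :
    vol p N (scaleEquiv (a + b) '' integralMatrices p N) =
      vol p N (scaleEquiv a '' integralMatrices p N) *
        vol p N (scaleEquiv b '' integralMatrices p N) := by
  rw [← vol_image, Set.image_image]
  simp only [scaleEquiv_add]

lemma vol_scaleEquiv_zero :
    vol p N (scaleEquiv 0 '' integralMatrices p N) = 1 := by
  rw [← vol_integralMatrices (p := p) (N := N)]
  congr 1
  have : ∀ Z : Matrix (Fin N) (Fin N) ℚ_[p], scaleEquiv 0 Z = Z := fun Z => by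
    ext i j; simp [scaleEquiv_apply]
  simp [this]

/-- The entry at `x` is a surjective additive map onto `ZMod p`, so its kernel has index `p`. -/
lemma card_entry_eq_zero (x : Fin N × Fin N) :
    Nat.card {M : Matrix (Fin N) (Fin N) (ZMod p) | M x.1 x.2 = 0} * p = p ^ (N * N) := by
  let f : Matrix (Fin N) (Fin N) (ZMod p) →+ ZMod p :=
    { toFun := fun M => M x.1 x.2, map_zero' := rfl, map_add' := fun _ _ => rfl }
  have hf : Function.Surjective f := fun c => ⟨Matrix.of fun _ _ => c, rfl⟩
  have h := f.ker.card_mul_index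
  rw [AddSubgroup.index_ker, f.range_eq_top.2 hf] at h
  have h1 : Nat.card (⊤ : AddSubgroup (ZMod p)) = p := by
    rw [AddSubgroup.card_top, Nat.card_zmod]
  have h2 : Nat.card (Matrix (Fin N) (Fin N) (ZMod p)) = p ^ (N * N) := by
    rw [card_matrix_zmod, Fintype.card_fin]
  rw [h1, h2] at h
  exact h

lemma vol_scaleEquiv_single (x : Fin N × Fin N) :
    vol p N (scaleEquiv (Pi.single x 1) '' integralMatrices p N) = (p : ENNReal)⁻¹ := by
  have hp : (p : ENNReal) ≠ 0 := by exact_mod_cast (Fact.out : p.Prime).ne_zero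
  have hp0 : (p : ℚ_[p]) ≠ 0 := by exact_mod_cast (Fact.out : p.Prime).ne_zero
  have himg : scaleEquiv (Pi.single x 1) '' integralMatrices p N =
      residueSet {M : Matrix (Fin N) (Fin N) (ZMod p) | M x.1 x.2 = 0} := by
    ext Z
    constructor
    · rintro ⟨W, hW, rfl⟩
      rw [← range_toQp] at hW
      obtain ⟨A, rfl⟩ := hW
      refine ⟨Matrix.of fun i j => if (i, j) = x then p * A i j else A i j, ?_, ?_⟩
      · simp
      · ext i j
        rw [scaleEquiv_apply, toQp_apply, toQp_apply, Matrix.of_apply]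
        by_cases h : (i, j) = x
        · subst h; simp
        · simp [h]
    · rintro ⟨A, hA, rfl⟩
      have hx : (p : ℤ_[p]) ∣ A x.1 x.2 := by
        have : A x.1 x.2 ∈ RingHom.ker (PadicInt.toZMod : ℤ_[p] →+* ZMod p) := hA
        rw [PadicInt.ker_toZMod, PadicInt.maximalIdeal_eq_span_p,
          Ideal.mem_span_singleton] at this
        exact this
      obtain ⟨c, hc⟩ := hx
      refine ⟨toQp (Matrix.of fun i j => if (i, j) = x then c else A i j), ?_, ?_⟩
      · rw [← range_toQp]; exact ⟨_, rfl⟩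
      · ext i j
        rw [scaleEquiv_apply, toQp_apply, toQp_apply, Matrix.of_apply]
        by_cases h : (i, j) = x
        · subst h; simp [hc]
        · simp [h]
  rw [himg, vol_residueSet]
  have h := card_entry_eq_zero (p := p) x
  refine ENNReal.eq_inv_of_mul_eq_one_left ?_
  rw [ENNReal.div_eq_inv_mul, mul_assoc]
  have h' : (Nat.card {M : Matrix (Fin N) (Fin N) (ZMod p) | M x.1 x.2 = 0} : ENNReal) * p =
      (p : ENNReal) ^ (N * N) := by exact_mod_cast h
  rw [h']
  exact ENNReal.inv_mul_cancel (by positivity) (by finiteness)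

/-- Scaling the entries by `p ^ a_{ij}` multiplies the volume by `p ^ (-∑ a_{ij})`. -/
lemma vol_scaleEquiv (a : Fin N × Fin N → ℤ) :
    vol p N (scaleEquiv a '' integralMatrices p N) = (p : ENNReal) ^ (-∑ x, a x) := by
  have hp : (p : ENNReal) ≠ 0 := by exact_mod_cast (Fact.out : p.Prime).ne_zero
  have hpt : (p : ENNReal) ≠ ⊤ := by finiteness
  -- The scaling factor is multiplicative in `a`, so the exponents obeying the formula form a
  -- subgroup. It contains the unit vectors, which generate.
  let P : AddSubgroup (Fin N × Fin N → ℤ) :=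
    { carrier := {a | vol p N (scaleEquiv a '' integralMatrices p N) = (p : ENNReal) ^ (-∑ x, a x)}
      zero_mem' := by simpa using vol_scaleEquiv_zero
      add_mem' := fun {a b} ha hb => by
        rw [Set.mem_ofPred_eq] at ha hb ⊢
        rw [vol_scaleEquiv_add, ha, hb, ← ENNReal.zpow_add hp hpt]
        simp only [Pi.add_apply, Finset.sum_add_distrib]
        congr 1; ring
      neg_mem' := fun {a} ha => by
        rw [Set.mem_ofPred_eq] at ha ⊢
        have h := vol_scaleEquiv_add (p := p) (-a) a
        rw [neg_add_cancel, vol_scaleEquiv_zero, ha] at h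
        rw [ENNReal.eq_inv_of_mul_eq_one_left h.symm, ← ENNReal.zpow_neg]
        simp }
  suffices a ∈ P from this
  rw [← Finset.univ_sum_single a]
  refine sum_mem fun x _ => ?_
  have : Pi.single x (a x) = a x • (Pi.single x 1 : Fin N × Fin N → ℤ) := by
    rw [← Pi.single_smul]; simp
  rw [this]
  refine zsmul_mem ?_ _
  change vol p N _ = _
  rw [vol_scaleEquiv_single]
  simp [ENNReal.zpow_neg]

/-! ### `GL(N, ℤ_p)`, its orbits, and measurability of `sing` -/

lemma isUnit_iff_toZMod_ne_zero (x : ℤ_[p]) : IsUnit x ↔ PadicInt.toZMod x ≠ 0 := by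
  rw [← not_iff_not, not_not, ← RingHom.mem_ker, PadicInt.ker_toZMod,
    IsLocalRing.mem_maximalIdeal, mem_nonunits_iff]

lemma exists_gl_iff_isUnit_det (A : Matrix (Fin N) (Fin N) ℤ_[p]) :
    (∃ g : GL (Fin N) ℤ_[p], g.1 = A) ↔ IsUnit A.det :=
  (Matrix.isUnit_iff_isUnit_det A)

lemma toZMod_det (A : Matrix (Fin N) (Fin N) ℤ_[p]) :
    PadicInt.toZMod A.det = (A.map PadicInt.toZMod).det := by
  rw [RingHom.map_det]
  rfl

/-- Since `ℤ_p` is local, invertibility of an integral matrix is decided by its determinant in the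
residue field. -/
lemma range_glQp : Set.range (glQp : GL (Fin N) ℤ_[p] → _) =
    residueSet {M : Matrix (Fin N) (Fin N) (ZMod p) | M.det ≠ 0} := by
  ext Z
  constructor
  · rintro ⟨g, rfl⟩
    refine ⟨g.1, ?_, rfl⟩
    change Matrix.det _ ≠ 0
    rw [← toZMod_det, ← isUnit_iff_toZMod_ne_zero, ← exists_gl_iff_isUnit_det]
    exact ⟨g, rfl⟩
  · rintro ⟨A, hA, rfl⟩
    change Matrix.det _ ≠ 0 at hA
    rw [← toZMod_det, ← isUnit_iff_toZMod_ne_zero, ← exists_gl_iff_isUnit_det] at hA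
    obtain ⟨g, rfl⟩ := hA
    exact ⟨g, rfl⟩

lemma isOpen_range_glQp : IsOpen (Set.range (glQp : GL (Fin N) ℤ_[p] → _)) := by
  rw [range_glQp]; exact isOpen_residueSet _

lemma isCompact_range_glQp : IsCompact (Set.range (glQp : GL (Fin N) ℤ_[p] → _)) := by
  have h : Set.range (glQp : GL (Fin N) ℤ_[p] → _) = toQp '' {A | ‖A.det‖ = 1} := by
    ext Z
    constructor
    · rintro ⟨g, rfl⟩
      exact ⟨g.1, norm_det_gl g, rfl⟩
    · rintro ⟨A, hA, rfl⟩
      obtain ⟨g, rfl⟩ := (exists_gl_iff_isUnit_det A).2 (PadicInt.isUnit_iff.2 hA)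
      exact ⟨g, rfl⟩
  rw [h]
  refine IsCompact.image (IsClosed.isCompact ?_) continuous_toQp
  have : Continuous fun A : Matrix (Fin N) (Fin N) ℤ_[p] => ‖A.det‖ :=
    continuous_norm.comp continuous_id.matrix_det
  exact isClosed_eq this continuous_const

/-- The orbit of a matrix under the two-sided action of `GL(N, ℤ_p)`. -/
def orbit (D : Matrix (Fin N) (Fin N) ℚ_[p]) : Set (Matrix (Fin N) (Fin N) ℚ_[p]) :=
  {Z | IntEquiv Z D}

lemma isCompact_orbit (D : Matrix (Fin N) (Fin N) ℚ_[p]) : IsCompact (orbit D) := by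
  have h : orbit D = (fun x : Matrix (Fin N) (Fin N) ℚ_[p] × Matrix (Fin N) (Fin N) ℚ_[p] =>
      x.1 * D * x.2) '' (Set.range (glQp : GL (Fin N) ℤ_[p] → _) ×ˢ
        Set.range (glQp : GL (Fin N) ℤ_[p] → _)) := by
    ext Z
    constructor
    · rintro ⟨B, C, rfl⟩
      exact ⟨(glQp B, glQp C), ⟨⟨B, rfl⟩, ⟨C, rfl⟩⟩, rfl⟩
    · rintro ⟨⟨_, _⟩, ⟨⟨B, rfl⟩, ⟨C, rfl⟩⟩, rfl⟩
      exact ⟨B, C, rfl⟩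
  rw [h]
  exact (isCompact_range_glQp.prod isCompact_range_glQp).image (by fun_prop)

lemma preimage_sing_singleton (k : Delta N) :
    sing p ⁻¹' {k} = orbit (diagMat p k.1) := by
  ext Z
  exact sing_eq_iff

instance : Countable (Delta N) :=
  inferInstanceAs (Countable {k : Fin N → WithBot ℤ // Antitone k})

theorem measurable_sing : Measurable (sing p : Matrix (Fin N) (Fin N) ℚ_[p] → Delta N) := by
  refine measurable_to_countable' fun k => ?_
  rw [preimage_sing_singleton]
  exact (isCompact_orbit _).measurableSet

/-! ### Coset decomposition of an orbit -/

/-- The subgroup `GL(N, ℤ_p) ∩ D GL(N, ℤ_p) D⁻¹` of `GL(N, ℤ_p)`. -/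
def conjInter (D : Matrix (Fin N) (Fin N) ℚ_[p]) : Subgroup (GL (Fin N) ℤ_[p]) where
  carrier := {g | ∃ g' : GL (Fin N) ℤ_[p], glQp g * D = D * glQp g'}
  one_mem' := ⟨1, by simp⟩
  mul_mem' := by
    rintro g h ⟨g', hg⟩ ⟨h', hh⟩
    exact ⟨g' * h', by rw [glQp_mul, mul_assoc, hh, ← mul_assoc, hg, mul_assoc, glQp_mul]⟩
  inv_mem' := by
    rintro g ⟨g', hg⟩
    refine ⟨g'⁻¹, ?_⟩
    have := congrArg (fun Z => glQp g⁻¹ * (Z * glQp g'⁻¹)) hg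
    simpa [mul_assoc] using this.symm

lemma isOpen_image_conjInter (D D' : Matrix (Fin N) (Fin N) ℚ_[p]) (h : D * D' = 1)
    (h' : D' * D = 1) : IsOpen (glQp '' (conjInter D : Set (GL (Fin N) ℤ_[p]))) := by
  have e : glQp '' (conjInter D : Set (GL (Fin N) ℤ_[p])) =
      Set.range (glQp : GL (Fin N) ℤ_[p] → _) ∩
        (fun Z => D' * Z * D) ⁻¹' Set.range (glQp : GL (Fin N) ℤ_[p] → _) := by
    ext Z
    constructor
    · rintro ⟨g, ⟨g', hg⟩, rfl⟩
      refine ⟨⟨g, rfl⟩, g', ?_⟩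
      change _ = D' * glQp g * D
      rw [mul_assoc, hg, ← mul_assoc, h', one_mul]
    · rintro ⟨⟨g, rfl⟩, g', hg⟩
      refine ⟨g, ⟨g', ?_⟩, rfl⟩
      rw [hg]
      simp [← mul_assoc, h]
  rw [e]
  exact isOpen_range_glQp.inter (isOpen_range_glQp.preimage (by fun_prop))

/-- The coset decompositions of an orbit and of `GL(N, ℤ_p)` compare their volumes. -/
lemma vol_orbit_mul (D D' : Matrix (Fin N) (Fin N) ℚ_[p]) (h : D * D' = 1) (h' : D' * D = 1) :
    vol p N (orbit D) * vol p N (glQp '' (conjInter D : Set (GL (Fin N) ℤ_[p]))) =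
      vol p N ((fun Z => D * Z) '' Set.range (glQp : GL (Fin N) ℤ_[p] → _)) *
        vol p N (Set.range (glQp : GL (Fin N) ℤ_[p] → _)) := by
  set H := conjInter D
  set G : Set (Matrix (Fin N) (Fin N) ℚ_[p]) := Set.range (glQp : GL (Fin N) ℤ_[p] → _)
  let Q := GL (Fin N) ℤ_[p] ⧸ H
  let S : Q → Set (Matrix (Fin N) (Fin N) ℚ_[p]) := fun q =>
    (fun Z => glQp q.out * Z) '' (glQp '' (H : Set (GL (Fin N) ℤ_[p])))
  let T : Q → Set (Matrix (Fin N) (Fin N) ℚ_[p]) := fun q =>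
    (fun Z => glQp q.out * Z) '' ((fun Z => D * Z) '' G)
  have hopen : ∀ (g : GL (Fin N) ℤ_[p]) (U : Set (Matrix (Fin N) (Fin N) ℚ_[p])), IsOpen U →
      IsOpen ((fun Z => glQp g * Z) '' U) := fun g U hU =>
    (mulLeftEquiv (glQp g) (glQp g⁻¹) (by simp) (by simp)).toHomeomorph.isOpenMap U hU
  have hHopen : IsOpen (glQp '' (H : Set (GL (Fin N) ℤ_[p]))) := isOpen_image_conjInter D D' h h'
  have hDG : IsOpen ((fun Z => D * Z) '' G) :=
    (mulLeftEquiv D D' h h').toHomeomorph.isOpenMap G isOpen_range_glQp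
  have hSm : ∀ q, MeasurableSet (S q) := fun q => (hopen _ _ hHopen).measurableSet
  have hTm : ∀ q, MeasurableSet (T q) := fun q => (hopen _ _ hDG).measurableSet
  have hglinj : Function.Injective (glQp : GL (Fin N) ℤ_[p] → _) := fun a b hab =>
    Units.ext (toQp_injective hab)
  have hSd : Pairwise (Function.onFun Disjoint S) := by
    intro q q' hq
    refine Set.disjoint_left.2 ?_
    rintro _ ⟨_, ⟨a, ha, rfl⟩, rfl⟩ ⟨_, ⟨b, hb, rfl⟩, e⟩
    refine hq ?_
    have e' : q'.out * b = q.out * a := hglinj (by simpa using e)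
    rw [← Quotient.out_eq q, ← Quotient.out_eq q']
    refine QuotientGroup.eq.2 ?_
    have : q.out⁻¹ * q'.out = a * b⁻¹ := by
      rw [inv_mul_eq_iff_eq_mul, ← mul_assoc, ← e']; simp
    rw [this]
    exact H.mul_mem ha (H.inv_mem hb)
  have hTd : Pairwise (Function.onFun Disjoint T) := by
    intro q q' hq
    refine Set.disjoint_left.2 ?_
    rintro _ ⟨_, ⟨_, ⟨a, rfl⟩, rfl⟩, rfl⟩ ⟨_, ⟨_, ⟨b, rfl⟩, rfl⟩, e⟩
    refine hq ?_
    rw [← Quotient.out_eq q, ← Quotient.out_eq q']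
    -- A common point `g' D b = g D a` gives `g⁻¹ g' D = D (a b⁻¹)`, which is membership in `H`.
    refine QuotientGroup.eq.2 ⟨a * b⁻¹, ?_⟩
    have := congrArg (fun Z => glQp q.out⁻¹ * (Z * glQp b⁻¹)) e
    simpa [mul_assoc] using this
  have hSu : G = ⋃ q, S q := by
    ext Z
    rw [Set.mem_iUnion]
    constructor
    · rintro ⟨g, rfl⟩
      refine ⟨(g : Q), _, ⟨(g : Q).out⁻¹ * g, ?_, rfl⟩, by simp⟩
      exact QuotientGroup.eq.1 (Quotient.out_eq (g : Q))
    · rintro ⟨q, _, ⟨a, _, rfl⟩, rfl⟩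
      exact ⟨q.out * a, by simp⟩
  have hTu : orbit D = ⋃ q, T q := by
    ext Z
    rw [Set.mem_iUnion]
    constructor
    · rintro ⟨g, c, rfl⟩
      obtain ⟨m, hm⟩ : (g : Q).out⁻¹ * g ∈ H := QuotientGroup.eq.1 (Quotient.out_eq (g : Q))
      refine ⟨(g : Q), _, ⟨_, ⟨m * c, rfl⟩, rfl⟩, ?_⟩
      change glQp (g : Q).out * (D * glQp (m * c)) = _
      rw [glQp_mul, ← mul_assoc D, ← hm]
      simp [mul_assoc]
    · rintro ⟨q, _, ⟨_, ⟨a, rfl⟩, rfl⟩, rfl⟩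
      exact ⟨q.out, a, by simp [mul_assoc]⟩
  have hSv : ∀ q, vol p N (S q) = vol p N (glQp '' (H : Set (GL (Fin N) ℤ_[p]))) := fun q =>
    vol_glQp_mul_image _ _
  have hTv : ∀ q, vol p N (T q) = vol p N ((fun Z => D * Z) '' G) := fun q =>
    vol_glQp_mul_image _ _
  have hpos : 0 < vol p N (glQp '' (H : Set (GL (Fin N) ℤ_[p]))) :=
    hHopen.measure_pos _ ⟨_, ⟨1, H.one_mem, rfl⟩⟩
  -- The cosets are disjoint sets of the same positive volume, so there are only countably many.
  have hcount : Countable Q := by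
    have := Measure.countable_meas_pos_of_disjoint_iUnion (μ := vol p N) hSm hSd
    simp only [hSv, hpos] at this
    exact Set.countable_univ_iff.1 this
  have hG : vol p N G = ENat.card Q * vol p N (glQp '' (H : Set (GL (Fin N) ℤ_[p]))) := by
    rw [hSu, measure_iUnion hSd hSm]
    simp only [hSv]
    rw [ENNReal.tsum_const]
  have hO : vol p N (orbit D) = ENat.card Q * vol p N ((fun Z => D * Z) '' G) := by
    rw [hTu, measure_iUnion hTd hTm]
    simp only [hTv]
    rw [ENNReal.tsum_const]
  -- The index of `H` is a common factor of both sides, so its finiteness is not needed.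
  rw [hO, hG]
  ring

/-! ### Counting matrices over `ZMod p` -/

/-- The number of invertible matrices over `ZMod p`. -/
lemma card_det_ne_zero (ι : Type*) [Fintype ι] [DecidableEq ι] :
    (Nat.card {M : Matrix ι ι (ZMod p) // M.det ≠ 0} : ℝ) =
      Nat.card (Matrix ι ι (ZMod p)) * qPochhammer (p : ℝ)⁻¹ (p : ℝ)⁻¹ (Fintype.card ι) := by
  have hp : (p : ℝ) ≠ 0 := by exact_mod_cast (Fact.out : p.Prime).ne_zero
  set n := Fintype.card ι
  let e : ι ≃ Fin n := Fintype.equivFin ι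
  have h1 : Nat.card {M : Matrix ι ι (ZMod p) // M.det ≠ 0} = Nat.card (GL (Fin n) (ZMod p)) := by
    refine (Nat.card_congr ((Matrix.reindex e e).subtypeEquiv (q := fun M => IsUnit M)
      fun M => ?_)).trans (Nat.card_congr ?_)
    · rw [Matrix.isUnit_iff_isUnit_det, Matrix.det_reindex_self, isUnit_iff_ne_zero]
    · exact (Equiv.ofBijective (fun u : GL (Fin n) (ZMod p) => (⟨u.1, u.isUnit⟩ : {M // IsUnit M}))
        ⟨fun u v h => Units.ext (congrArg Subtype.val h), fun ⟨_, u, hu⟩ => ⟨u, Subtype.ext hu⟩⟩).symm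
  have h2 : Nat.card (Matrix ι ι (ZMod p)) = p ^ (n * n) := card_matrix_zmod ι
  rw [h1, h2, Matrix.card_GL_field, ZMod.card, qPochhammer, pow_mul, Nat.cast_pow, Nat.cast_pow]
  have h3 : ((p : ℝ) ^ n) ^ n = ∏ _j ∈ Finset.range n, (p : ℝ) ^ n := by simp
  -- The group order is `∏ (p ^ n - p ^ i)`; reversing the Pochhammer product matches its factors `1
  -- - p ^ (i - n)` with these.
  rw [h3, ← Finset.prod_mul_distrib, ← Finset.prod_range_reflect, ← Fin.prod_univ_eq_prod_range,
    Nat.cast_prod]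
  refine Finset.prod_congr rfl fun i _ => ?_
  have hi : (i : ℕ) < n := i.2
  rw [Nat.cast_sub (Nat.pow_le_pow_right (Fact.out : p.Prime).pos hi.le)]
  push_cast
  rw [mul_sub, mul_one, ← pow_succ', inv_pow, show n - 1 - (i : ℕ) + 1 = n - i by omega]
  congr 1
  rw [eq_mul_inv_iff_mul_eq₀ (by positivity), ← pow_add]
  congr 1
  omega

lemma vol_range_glQp : (vol p N (Set.range (glQp : GL (Fin N) ℤ_[p] → _))).toReal =
    qPochhammer (p : ℝ)⁻¹ (p : ℝ)⁻¹ N := by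
  have hp : (p : ℝ) ≠ 0 := by exact_mod_cast (Fact.out : p.Prime).ne_zero
  have h2 : Nat.card (Matrix (Fin N) (Fin N) (ZMod p)) = p ^ (N * N) := by
    rw [card_matrix_zmod, Fintype.card_fin]
  have h := card_det_ne_zero (p := p) (Fin N)
  rw [h2, Fintype.card_fin] at h
  rw [range_glQp, vol_residueSet, ENNReal.toReal_div, ENNReal.toReal_pow, ENNReal.toReal_natCast,
    ENNReal.toReal_natCast, div_eq_iff (by positivity), mul_comm]
  push_cast at h
  exact h

section Blocks

variable {ι V R : Type*} [Fintype V] [DecidableEq V]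

/-- A square matrix consists of its diagonal blocks and its entries outside these blocks. -/
def blocksEquiv (b : ι → V) : Matrix ι ι R ≃
    (∀ v, Matrix {i // b i = v} {i // b i = v} R) × ({x : ι × ι // b x.1 ≠ b x.2} → R) where
  toFun M := (fun v => M.toSquareBlock b v, fun x => M x.1.1 x.1.2)
  invFun y := Matrix.of fun i j =>
    if h : b i = b j then y.1 (b j) ⟨i, h⟩ ⟨j, rfl⟩ else y.2 ⟨(i, j), h⟩
  left_inv M := by
    ext i j
    by_cases h : b i = b j <;> simp [Matrix.toSquareBlock_def]
  right_inv y := by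
    refine Prod.ext ?_ ?_
    · funext v
      ext ⟨i, hi⟩ ⟨j, hj⟩
      subst hj
      simp [Matrix.toSquareBlock_def, hi]
    · funext x
      simp [x.2]

/-- The proportion of matrices over `ZMod p` with invertible diagonal blocks. -/
lemma card_blocks_det_ne_zero [Fintype ι] [DecidableEq ι] (b : ι → V) :
    (Nat.card {M : Matrix ι ι (ZMod p) // ∀ v, (M.toSquareBlock b v).det ≠ 0} : ℝ) =
      Nat.card (Matrix ι ι (ZMod p)) *
        ∏ v, qPochhammer (p : ℝ)⁻¹ (p : ℝ)⁻¹ (Fintype.card {i // b i = v}) := by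
  have h1 : Nat.card {M : Matrix ι ι (ZMod p) // ∀ v, (M.toSquareBlock b v).det ≠ 0} =
      (∏ v, Nat.card {B : Matrix {i // b i = v} {i // b i = v} (ZMod p) // B.det ≠ 0}) *
        Nat.card ({x : ι × ι // b x.1 ≠ b x.2} → ZMod p) := by
    rw [← Nat.card_pi, ← Nat.card_prod]
    refine Nat.card_congr (((blocksEquiv b).subtypeEquiv
      (q := fun y : (∀ v, Matrix {i // b i = v} {i // b i = v} (ZMod p)) × _ =>
        ∀ v, (y.1 v).det ≠ 0) fun M => Iff.rfl).trans ?_)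
    exact (Equiv.prodSubtypeFstEquivSubtypeProd
      (p := fun y : ∀ v, Matrix {i // b i = v} {i // b i = v} (ZMod p) =>
        ∀ v, (y v).det ≠ 0)).trans
      (Equiv.prodCongr (Equiv.subtypePiEquivPi
        (p := fun v (B : Matrix {i // b i = v} {i // b i = v} (ZMod p)) => B.det ≠ 0))
        (Equiv.refl _))
  have h2 : Nat.card (Matrix ι ι (ZMod p)) =
      (∏ v, Nat.card (Matrix {i // b i = v} {i // b i = v} (ZMod p))) *
        Nat.card ({x : ι × ι // b x.1 ≠ b x.2} → ZMod p) := by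
    rw [← Nat.card_pi, ← Nat.card_prod]
    exact Nat.card_congr (blocksEquiv b)
  rw [h1, h2]
  push_cast
  simp only [card_det_ne_zero, Finset.prod_mul_distrib]
  ring

end Blocks

/-! ### Volume of the subgroup `conjInter` -/

lemma exists_toQp_eq_scaleEquiv {a : Fin N × Fin N → ℤ} (ha : ∀ x, 0 ≤ a x)
    (A : Matrix (Fin N) (Fin N) ℤ_[p]) : ∃ B, toQp B = scaleEquiv a (toQp A) := by
  have h : scaleEquiv a (toQp A) ∈ (integralMatrices p N : Set (Matrix (Fin N) (Fin N) ℚ_[p])) := by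
    intro i j
    have hp : 1 ≤ (p : ℝ) := by exact_mod_cast (Fact.out : p.Prime).one_lt.le
    rw [scaleEquiv_apply, norm_mul, Padic.norm_p_zpow]
    exact mul_le_one₀ (zpow_le_one_of_nonpos₀ hp (by simpa using ha (i, j))) (norm_nonneg _)
      (PadicInt.norm_le_one _)
  rw [← range_toQp] at h
  exact h

lemma toReal_natCast_zpow (m : ℕ) (n : ℤ) : ((m : ENNReal) ^ n).toReal = (m : ℝ) ^ n := by
  cases n <;> simp [ENNReal.toReal_pow, ENNReal.toReal_inv]

section Stabilizer

variable {V : Type*} [Fintype V] [LinearOrder V] {k : Fin N → ℤ} {b : Fin N → V}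

/-- Entries of `B` with `k i < k j` vanish mod `p`, so `B` is block triangular there. Within a level
set of `k` the scaling exponent is `0`, so its diagonal blocks are those of `A`. -/
lemma isUnit_det_of_scaleEquiv (hb : ∀ i j, b j < b i ↔ k i < k j)
    {A B : Matrix (Fin N) (Fin N) ℤ_[p]}
    (hAB : toQp B = scaleEquiv (fun x => max 0 (k x.2 - k x.1)) (toQp A)) :
    IsUnit B.det ↔ ∀ v, ((A.map PadicInt.toZMod).toSquareBlock b v).det ≠ 0 := by
  have hp : 1 < (p : ℝ) := by exact_mod_cast (Fact.out : p.Prime).one_lt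
  have hent : ∀ i j, (B i j : ℚ_[p]) = (p : ℚ_[p]) ^ max 0 (k j - k i) * A i j := fun i j =>
    congrFun (congrFun hAB i) j
  have htri : (B.map PadicInt.toZMod).BlockTriangular b := by
    intro i j hij
    rw [hb] at hij
    rw [Matrix.map_apply, ← map_zero PadicInt.toZMod, toZMod_eq_iff, sub_zero, PadicInt.norm_def,
      hent, norm_mul, Padic.norm_p_zpow]
    refine mul_lt_one_of_nonneg_of_lt_one_left (by positivity) ?_ (PadicInt.norm_le_one _)
    exact zpow_lt_one_of_neg₀ hp (by omega)
  have hblock : ∀ v, (B.map PadicInt.toZMod).toSquareBlock b v =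
      (A.map PadicInt.toZMod).toSquareBlock b v := by
    intro v
    ext ⟨i, hi⟩ ⟨j, hj⟩
    have h1 : ¬ k i < k j := by rw [← hb, hi, hj]; exact lt_irrefl _
    have h2 := hent i j
    rw [max_eq_left (by omega), zpow_zero, one_mul] at h2
    simp only [Matrix.toSquareBlock_def, Matrix.of_apply, Matrix.map_apply]
    rw [PadicInt.ext h2]
  rw [isUnit_iff_toZMod_ne_zero, toZMod_det, htri.det_fintype, Finset.prod_ne_zero_iff]
  simp only [hblock, Finset.mem_univ, true_imp_iff]

lemma image_conjInter_diagMat (hb : ∀ i j, b j < b i ↔ k i < k j) :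
    glQp '' (conjInter (diagMat p fun j => (k j : WithBot ℤ)) : Set (GL (Fin N) ℤ_[p])) =
      scaleEquiv (fun x => max 0 (k x.2 - k x.1)) '' residueSet
        {M : Matrix (Fin N) (Fin N) (ZMod p) | ∀ v, (M.toSquareBlock b v).det ≠ 0} := by
  have hp : (p : ℚ_[p]) ≠ 0 := by exact_mod_cast (Fact.out : p.Prime).ne_zero
  ext Z
  constructor
  · rintro ⟨g, ⟨g', hg⟩, rfl⟩
    -- From `g D = D g'` one gets `g i j = p ^ (k j - k i) * g' i j`. Taking `g'` where this
    -- exponent is nonnegative and `g` elsewhere undoes the scaling integrally.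
    let A : Matrix (Fin N) (Fin N) ℤ_[p] := Matrix.of fun i j =>
      if k i ≤ k j then g'.1 i j else g.1 i j
    have hA : toQp g.1 = scaleEquiv (fun x => max 0 (k x.2 - k x.1)) (toQp A) := by
      ext i j
      rw [scaleEquiv_apply, toQp_apply, toQp_apply]
      change _ = _ * (((if k i ≤ k j then g'.1 i j else g.1 i j : ℤ_[p])) : ℚ_[p])
      split_ifs with h
      · have e := congrFun (congrFun hg i) j
        rw [diagMat, Matrix.mul_diagonal, Matrix.diagonal_mul, primePowNeg_coe,
          primePowNeg_coe] at e
        change (g.1 i j : ℚ_[p]) * _ = _ * (g'.1 i j : ℚ_[p]) at e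
        rw [max_eq_right (by simpa using h), sub_eq_add_neg, zpow_add₀ hp, mul_assoc, ← e,
          mul_left_comm, ← zpow_add₀ hp]
        simp
      · rw [max_eq_left (by simp; omega)]
        simp
    refine ⟨toQp A, ⟨A, (isUnit_det_of_scaleEquiv hb hA).1 ?_, rfl⟩, hA.symm⟩
    exact (exists_gl_iff_isUnit_det _).1 ⟨g, rfl⟩
  · rintro ⟨_, ⟨A, hA, rfl⟩, rfl⟩
    obtain ⟨B, hB⟩ := exists_toQp_eq_scaleEquiv
      (a := fun x : Fin N × Fin N => max 0 (k x.2 - k x.1)) (fun _ => le_max_left _ _) A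
    -- This is `D⁻¹ B D`, since `max 0 (k j - k i) + (k i - k j) = max 0 (k i - k j)`.
    obtain ⟨B', hB'⟩ := exists_toQp_eq_scaleEquiv
      (a := fun x : Fin N × Fin N => max 0 (k x.1 - k x.2)) (fun _ => le_max_left _ _) A
    have e : toQp B * (diagMat p fun j => (k j : WithBot ℤ)) =
        (diagMat p fun j => (k j : WithBot ℤ)) * toQp B' := by
      ext i j
      rw [diagMat, Matrix.mul_diagonal, Matrix.diagonal_mul, primePowNeg_coe, primePowNeg_coe,
        hB, hB', scaleEquiv_apply, scaleEquiv_apply, ← mul_assoc, mul_right_comm,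
        ← zpow_add₀ hp, ← zpow_add₀ hp]
      congr 2
      rcases le_total (k i) (k j) with h | h
      · rw [max_eq_right (by simpa using h), max_eq_left (by simpa using h)]; ring
      · rw [max_eq_left (by simpa using h), max_eq_right (by simpa using h)]; ring
    have hBu := (isUnit_det_of_scaleEquiv hb hB).2 hA
    have hdet : B.det = B'.det := by
      have h := congrArg Matrix.det e
      rw [Matrix.det_mul, Matrix.det_mul, mul_comm, det_toQp, det_toQp] at h
      refine PadicInt.ext (mul_left_cancel₀ ?_ h)
      rw [diagMat, Matrix.det_diagonal, Finset.prod_ne_zero_iff]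
      exact fun i _ => zpow_ne_zero _ hp
    obtain ⟨g, rfl⟩ := (exists_gl_iff_isUnit_det B).2 hBu
    obtain ⟨g', rfl⟩ := (exists_gl_iff_isUnit_det B').2 (hdet ▸ hBu)
    exact ⟨g, ⟨g', e⟩, hB⟩

lemma vol_image_conjInter_diagMat (hb : ∀ i j, b j < b i ↔ k i < k j) :
    (vol p N (glQp '' (conjInter (diagMat p fun j => (k j : WithBot ℤ)) :
      Set (GL (Fin N) ℤ_[p])))).toReal =
      (p : ℝ) ^ (-∑ x : Fin N × Fin N, max 0 (k x.2 - k x.1)) *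
        ∏ v, qPochhammer (p : ℝ)⁻¹ (p : ℝ)⁻¹ (Nat.card {i // b i = v}) := by
  have hp : (p : ℝ) ≠ 0 := by exact_mod_cast (Fact.out : p.Prime).ne_zero
  have h := card_blocks_det_ne_zero (p := p) b
  have h2 : Nat.card (Matrix (Fin N) (Fin N) (ZMod p)) = p ^ (N * N) := by
    rw [card_matrix_zmod, Fintype.card_fin]
  rw [h2] at h
  rw [image_conjInter_diagMat hb, vol_image, vol_scaleEquiv, vol_residueSet, ENNReal.toReal_mul,
    toReal_natCast_zpow, ENNReal.toReal_div, ENNReal.toReal_pow, ENNReal.toReal_natCast,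
    ENNReal.toReal_natCast]
  congr 1
  rw [div_eq_iff (by positivity), mul_comm]
  simp only [Nat.card_eq_fintype_card (α := {i // b i = _})]
  push_cast at h
  exact h

end Stabilizer

/-! ### Volume of an orbit -/

lemma qPochhammer_pos {q : ℝ} (h0 : 0 ≤ q) (h1 : q < 1) (n : ℕ) : 0 < qPochhammer q q n := by
  refine Finset.prod_pos fun j _ => ?_
  have : q * q ^ j ≤ q * 1 := mul_le_mul_of_nonneg_left (pow_le_one₀ h0 h1.le) h0
  linarith

lemma inv_prime_lt_one : (p : ℝ)⁻¹ < 1 :=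
  inv_lt_one_of_one_lt₀ (by exact_mod_cast (Fact.out : p.Prime).one_lt)

lemma diagMat_mul_diagMat_neg (k : Fin N → ℤ) :
    diagMat p (fun j => (k j : WithBot ℤ)) * diagMat p (fun j => ((-k j : ℤ) : WithBot ℤ)) = 1 := by
  have hp : (p : ℚ_[p]) ≠ 0 := by exact_mod_cast (Fact.out : p.Prime).ne_zero
  rw [diagMat, diagMat, Matrix.diagonal_mul_diagonal]
  simp only [primePowNeg_coe, ← zpow_add₀ hp]
  simp

lemma vol_diagMat_mul_image (k : Fin N → ℤ) (S : Set (Matrix (Fin N) (Fin N) ℚ_[p])) :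
    (vol p N ((fun Z => diagMat p (fun j => (k j : WithBot ℤ)) * Z) '' S)).toReal =
      (p : ℝ) ^ (N * ∑ j, k j) * (vol p N S).toReal := by
  have h : (fun Z => diagMat p (fun j => (k j : WithBot ℤ)) * Z) '' S =
      scaleEquiv (fun x => -k x.1) '' S := by
    refine Set.image_congr fun Z _ => ?_
    ext i j
    rw [scaleEquiv_apply, diagMat, Matrix.diagonal_mul, primePowNeg_coe]
  rw [h, vol_image, vol_scaleEquiv, ENNReal.toReal_mul, toReal_natCast_zpow]
  congr 2
  rw [Fintype.sum_prod_type]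
  simp [Finset.mul_sum]

/-- The volume of the set of matrices with given finite singular numbers. -/
theorem vol_orbit_diagMat (k : Fin N → ℤ) :
    (vol p N (orbit (diagMat p fun j => (k j : WithBot ℤ)))).toReal =
      (p : ℝ) ^ (∑ x : Fin N × Fin N, max (k x.1) (k x.2)) *
        (qPochhammer (p : ℝ)⁻¹ (p : ℝ)⁻¹ N ^ 2 / ∏ᶠ i : WithBot ℤ,
          qPochhammer (p : ℝ)⁻¹ (p : ℝ)⁻¹ (Finset.univ.filter fun j => (k j : WithBot ℤ) = i).card)
      := by
  have hp : (p : ℝ) ≠ 0 := by exact_mod_cast (Fact.out : p.Prime).ne_zero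
  let s : Finset (WithBot ℤ) := Finset.univ.image fun j => (k j : WithBot ℤ)
  -- Block triangularity means vanishing where `b j < b i`, so the blocks are ordered oppositely to
  -- the values of `k`.
  let b : Fin N → (↥s)ᵒᵈ := fun j => OrderDual.toDual
    ⟨(k j : WithBot ℤ), Finset.mem_image_of_mem _ (Finset.mem_univ j)⟩
  have hb : ∀ i j, b j < b i ↔ k i < k j := fun i j => WithBot.coe_lt_coe
  have hprod : ∏ v, qPochhammer (p : ℝ)⁻¹ (p : ℝ)⁻¹ (Nat.card {i // b i = v}) =
      ∏ᶠ i : WithBot ℤ, qPochhammer (p : ℝ)⁻¹ (p : ℝ)⁻¹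
        (Finset.univ.filter fun j => (k j : WithBot ℤ) = i).card := by
    rw [finprod_eq_prod_of_mulSupport_subset (s := s) (fun i : WithBot ℤ =>
      qPochhammer (p : ℝ)⁻¹ (p : ℝ)⁻¹ (Finset.univ.filter fun j => (k j : WithBot ℤ) = i).card),
      ← Finset.prod_coe_sort s]
    · refine Fintype.prod_equiv OrderDual.ofDual _ _ fun v => ?_
      rw [Nat.card_eq_fintype_card, Fintype.card_subtype]
      congr 2
      ext i
      simp only [Finset.mem_filter, Finset.mem_univ, true_and]
      exact ⟨fun h => congrArg (fun w => (OrderDual.ofDual w).1) h, fun h => Subtype.ext h⟩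
    · intro i hi
      by_contra hcon
      refine hi ?_
      have : (Finset.univ.filter fun j => (k j : WithBot ℤ) = i) = ∅ := by
        rw [Finset.filter_eq_empty_iff]
        intro j _ hj
        exact hcon (by simp [s, ← hj])
      simp only [this]
      simp [qPochhammer]
  have hpos : 0 < ∏ v, qPochhammer (p : ℝ)⁻¹ (p : ℝ)⁻¹ (Nat.card {i // b i = v}) :=
    Finset.prod_pos fun v _ => qPochhammer_pos (by positivity) inv_prime_lt_one _
  have h := congrArg ENNReal.toReal (vol_orbit_mul _ _ (diagMat_mul_diagMat_neg (p := p) k)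
    (by simpa using diagMat_mul_diagMat_neg (p := p) (fun j => -k j)))
  rw [ENNReal.toReal_mul, ENNReal.toReal_mul, vol_image_conjInter_diagMat hb,
    vol_diagMat_mul_image, vol_range_glQp] at h
  rw [← hprod, mul_div_assoc', eq_div_iff hpos.ne']
  have hexp : ∑ x : Fin N × Fin N, max (k x.1) (k x.2) =
      N * ∑ j, k j + ∑ x : Fin N × Fin N, max 0 (k x.2 - k x.1) := by
    have h1 : (N : ℤ) * ∑ j, k j = ∑ x : Fin N × Fin N, k x.1 := by
      rw [Fintype.sum_prod_type]; simp [Finset.mul_sum]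
    rw [h1, ← Finset.sum_add_distrib]
    refine Finset.sum_congr rfl fun x _ => ?_
    omega
  rw [hexp, zpow_add₀ hp]
  set c := ∑ x : Fin N × Fin N, max 0 (k x.2 - k x.1)
  have hc : (p : ℝ) ^ c * (p : ℝ) ^ (-c) = 1 := by rw [← zpow_add₀ hp]; simp
  set P := ∏ v, qPochhammer (p : ℝ)⁻¹ (p : ℝ)⁻¹ (Nat.card {i // b i = v})
  linear_combination (p : ℝ) ^ c * h -
    (vol p N (orbit (diagMat p fun j => (k j : WithBot ℤ)))).toReal * P * hc

/-! ### Singular matrices form a null set -/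

open Classical in
-- The determinant is the characteristic polynomial of `-Z`, of degree `N`, evaluated at `n`.
lemma card_det_add_natCast_eq_zero_le (Z : Matrix (Fin N) (Fin N) ℚ_[p]) (M : ℕ) :
    ((Finset.range M).filter fun n : ℕ => (Z + Matrix.scalar (Fin N) (n : ℚ_[p])).det = 0).card
      ≤ N := by
  have hne : (-Z).charpoly ≠ 0 := (Matrix.charpoly_monic _).ne_zero
  have hdeg : (-Z).charpoly.natDegree = N := by
    rw [Matrix.charpoly_natDegree_eq_dim, Fintype.card_fin]
  rw [← Finset.card_map (⟨fun n : ℕ => (n : ℚ_[p]), Nat.cast_injective⟩ : ℕ ↪ ℚ_[p])]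
  refine (Polynomial.card_le_degree_of_subset_roots (p := (-Z).charpoly) fun x hx => ?_).trans
    hdeg.le
  rw [Finset.mem_val, Finset.mem_map] at hx
  obtain ⟨n, hn, rfl⟩ := hx
  rw [Polynomial.mem_roots hne, Polynomial.IsRoot, Matrix.eval_charpoly, sub_neg_eq_add, add_comm]
  exact (Finset.mem_filter.1 hn).2

/-- Singular matrices form a null set. -/
theorem vol_det_eq_zero : vol p N {Z | Z.det = 0} = 0 := by
  let K : ℕ → Set (Matrix (Fin N) (Fin N) ℚ_[p]) := fun R => {Z | ∀ i j, ‖Z i j‖ ≤ R}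
  have hK : ∀ R, IsCompact (K R) := fun R => by
    have h : IsCompact (Set.univ.pi fun _ : Fin N => Set.univ.pi fun _ : Fin N =>
        Metric.closedBall (0 : ℚ_[p]) R) :=
      isCompact_univ_pi fun _ => isCompact_univ_pi fun _ => isCompact_closedBall _ _
    have e : K R = Set.univ.pi fun _ : Fin N => Set.univ.pi fun _ : Fin N =>
        Metric.closedBall (0 : ℚ_[p]) R :=
      Set.ext fun Z => ⟨fun hZ i _ j _ => mem_closedBall_zero_iff.2 (hZ i j),
        fun hZ i j => mem_closedBall_zero_iff.1 (hZ i trivial j trivial)⟩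
    exact e ▸ h
  have hadd : ∀ (R : ℕ) (c : ℚ_[p]) (Z : Matrix (Fin N) (Fin N) ℚ_[p]), 1 ≤ R → ‖c‖ ≤ 1 → Z ∈ K R →
      Z + Matrix.scalar (Fin N) c ∈ K R := by
    intro R c Z hR hc hZ i j
    refine (Padic.nonarchimedean _ _).trans (max_le (hZ i j) ?_)
    have hR' : (1 : ℝ) ≤ R := by exact_mod_cast hR
    rw [Matrix.scalar_apply, Matrix.diagonal_apply]
    split_ifs
    · exact hc.trans hR'
    · simp
  have hclosed : ∀ n : ℕ, IsClosed {Z : Matrix (Fin N) (Fin N) ℚ_[p] |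
      (Z + Matrix.scalar (Fin N) (n : ℚ_[p])).det = 0} := fun n =>
    isClosed_eq (by fun_prop) continuous_const
  have hR : ∀ R : ℕ, 1 ≤ R → vol p N ({Z | Z.det = 0} ∩ K R) = 0 := by
    intro R hR
    -- These translates by integer scalars stay in `K R` and have equal volume, yet each point lies
    -- in at most `N` of them. Hence `M` times the volume is at most `N * vol (K R)` for every `M`,
    -- which forces it to be zero.
    let S : ℕ → Set (Matrix (Fin N) (Fin N) ℚ_[p]) := fun n =>
      {Z | (Z + Matrix.scalar (Fin N) (n : ℚ_[p])).det = 0} ∩ K R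
    have hSm : ∀ n, MeasurableSet (S n) := fun n =>
      ((hclosed n).inter (hK R).isClosed).measurableSet
    have hSv : ∀ n, vol p N (S n) = vol p N ({Z | Z.det = 0} ∩ K R) := by
      intro n
      rw [← measure_preimage_add_right (vol p N) (Matrix.scalar (Fin N) (n : ℚ_[p]))
        ({Z | Z.det = 0} ∩ K R)]
      congr 1
      ext Z
      have hn : ‖(n : ℚ_[p])‖ ≤ 1 := by exact_mod_cast Padic.norm_int_le_one n
      refine and_congr_right fun _ => ⟨hadd R n Z hR hn, fun h => ?_⟩
      have h' := hadd R (-n) _ hR (by rwa [norm_neg]) h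
      rwa [map_neg, add_neg_cancel_right] at h'
    by_contra hne
    obtain ⟨M, hM⟩ := ENNReal.exists_nat_mul_gt hne
      (b := N * vol p N (K R)) (ENNReal.mul_ne_top (by finiteness) (hK R).measure_lt_top.ne)
    refine hM.not_ge ?_
    calc (M : ENNReal) * vol p N ({Z | Z.det = 0} ∩ K R)
        = ∑ n ∈ Finset.range M, vol p N (S n) := by simp [hSv]
      _ = ∑ n ∈ Finset.range M, ∫⁻ Z, (S n).indicator 1 Z ∂vol p N := by
        simp only [lintegral_indicator_one (hSm _)]
      _ = ∫⁻ Z, ∑ n ∈ Finset.range M, (S n).indicator 1 Z ∂vol p N :=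
        (lintegral_finsetSum _ fun n _ => measurable_one.indicator (hSm n)).symm
      _ ≤ ∫⁻ Z, (K R).indicator (fun _ => (N : ENNReal)) Z ∂vol p N := by
        refine lintegral_mono fun Z => ?_
        by_cases hZ : Z ∈ K R
        · rw [Set.indicator_of_mem hZ]
          have := card_det_add_natCast_eq_zero_le Z M
          rw [Finset.card_filter] at this
          refine le_trans (le_of_eq ?_) (Nat.cast_le.2 this)
          rw [Nat.cast_sum]
          refine Finset.sum_congr rfl fun n _ => ?_
          classical
          rw [Set.indicator_apply, Nat.cast_ite, Nat.cast_one, Nat.cast_zero]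
          exact if_congr (and_iff_left hZ) rfl rfl
        · rw [Set.indicator_of_notMem hZ]
          simp [S, hZ]
      _ = N * vol p N (K R) := by
        rw [lintegral_indicator_const (hK R).isClosed.measurableSet]
  have hcover : {Z : Matrix (Fin N) (Fin N) ℚ_[p] | Z.det = 0} ⊆
      ⋃ R : ℕ, {Z | Z.det = 0} ∩ K (R + 1) := by
    intro Z hZ
    obtain ⟨R, hRZ⟩ := exists_nat_ge (∑ i, ∑ j, ‖Z i j‖)
    refine Set.mem_iUnion.2 ⟨R, hZ, fun i j => ?_⟩
    have h1 : ‖Z i j‖ ≤ ∑ j, ‖Z i j‖ :=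
      Finset.single_le_sum (f := fun j => ‖Z i j‖) (fun _ _ => norm_nonneg _) (Finset.mem_univ j)
    have h2 : ∑ j, ‖Z i j‖ ≤ ∑ i, ∑ j, ‖Z i j‖ :=
      Finset.single_le_sum (f := fun i => ∑ j, ‖Z i j‖)
        (fun _ _ => Finset.sum_nonneg fun _ _ => norm_nonneg _) (Finset.mem_univ i)
    push_cast
    linarith
  refine measure_mono_null hcover (measure_iUnion_null fun R => hR _ (by omega))

/-! ### Identities for the exponents -/

/-- The sum of the pairwise maxima of a non-increasing tuple. -/
lemma sum_max_eq (k : Fin N → ℤ) (hk : Antitone k) :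
    ((∑ x : Fin N × Fin N, max (k x.1) (k x.2) : ℤ) : ℝ) =
      -∑ j : Fin N, (2 * ((j : ℝ) + 1) - 2 * (N : ℝ) - 1) * (k j : ℝ) := by
  -- The maximum sits at the smaller index. With indices from `0`, `k j` is counted `(N - 1 - j) +
  -- (N - j)` times.
  have h : ∀ a b : Fin N, max (k a) (k b) =
      (if b < a then k b else 0) + (if a ≤ b then k a else 0) := by
    intro a b
    rcases lt_or_ge b a with h | h
    · rw [if_pos h, if_neg h.not_ge, add_zero, max_eq_right (hk h.le)]
    · rw [if_neg h.not_gt, if_pos h, zero_add, max_eq_left (hk h)]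
  have h1 : ∑ a : Fin N, ∑ b : Fin N, (if b < a then k b else 0) =
      ∑ b : Fin N, ((N - 1 - (b : ℕ) : ℕ) : ℤ) * k b := by
    rw [Finset.sum_comm]
    refine Finset.sum_congr rfl fun b _ => ?_
    rw [← Finset.sum_filter, Finset.sum_const, nsmul_eq_mul, Finset.filter_lt_eq_Ioi,
      Fin.card_Ioi]
  have h2 : ∑ a : Fin N, ∑ b : Fin N, (if a ≤ b then k a else 0) =
      ∑ a : Fin N, ((N - (a : ℕ) : ℕ) : ℤ) * k a := by
    refine Finset.sum_congr rfl fun a _ => ?_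
    rw [← Finset.sum_filter, Finset.sum_const, nsmul_eq_mul, Finset.filter_le_eq_Ici,
      Fin.card_Ici]
  rw [Fintype.sum_prod_type]
  simp only [h, Finset.sum_add_distrib]
  rw [h1, h2, ← Finset.sum_add_distrib, ← Finset.sum_neg_distrib]
  push_cast
  refine Finset.sum_congr rfl fun j _ => ?_
  have hj : (j : ℕ) + 1 ≤ N := j.2
  rw [Nat.sub_sub, Nat.cast_sub (by omega), Nat.cast_sub (by omega)]
  push_cast
  ring

/-- A weighted sum over the values of a tuple in terms of the multiplicities. -/
lemma finsum_mult (k : Fin N → ℤ) (P : ℤ → Prop) [DecidablePred P] (g : ℤ → ℝ) :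
    (∑ᶠ (j : ℤ) (_ : P j), g j * ((Finset.univ.filter fun a => k a = j).card : ℝ)) =
      ∑ a, if P (k a) then g (k a) else 0 := by
  rw [Finset.sum_comp (fun j => if P j then g j else 0) k,
    finsum_eq_sum_of_support_subset (s := Finset.univ.image k)]
  · refine Finset.sum_congr rfl fun j _ => ?_
    rw [finsum_eq_if, nsmul_eq_mul]
    split_ifs <;> ring
  · intro j hj
    by_contra hcon
    refine hj ?_
    have : (Finset.univ.filter fun a => k a = j) = ∅ := by
      rw [Finset.filter_eq_empty_iff]
      exact fun a _ ha => hcon (by simp [← ha])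
    simp [this]

lemma sum_Icc_ite_le {m c : ℤ} (h : c ≤ m) :
    ∑ i ∈ Finset.Icc 1 m, (if i ≤ c then 1 else 0 : ℝ) = ((max 0 c : ℤ) : ℝ) := by
  rw [← Finset.sum_filter, Finset.sum_const, nsmul_eq_mul, mul_one]
  have : (Finset.Icc 1 m).filter (fun i => i ≤ c) = Finset.Icc 1 c := by
    ext i; simp only [Finset.mem_filter, Finset.mem_Icc]; omega
  rw [this, Int.card_Icc]
  have : (((c + 1 - 1).toNat : ℤ) : ℝ) = ((max 0 c : ℤ) : ℝ) := by congr 1; omega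
  exact_mod_cast this

/-- The sum of the squares of the conjugate partition of the positive part of a tuple. -/
lemma finsum_sq_card_ge (k : Fin N → ℤ) :
    (∑ᶠ (i : ℤ) (_ : 1 ≤ i), (∑ a, if i ≤ k a then (1 : ℝ) else 0) ^ 2) =
      ((∑ x : Fin N × Fin N, max 0 (min (k x.1) (k x.2)) : ℤ) : ℝ) := by
  set m := ∑ a, |k a|
  have hm : ∀ a, k a ≤ m := fun a => (le_abs_self _).trans
    (Finset.single_le_sum (f := fun a => |k a|) (fun _ _ => abs_nonneg _) (Finset.mem_univ a))
  rw [finsum_eq_sum_of_support_subset (s := Finset.Icc 1 m)]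
  -- The square counts pairs with both entries at least `i`; each pair is then counted once for
  -- every `i` from `1` to its minimum.
  · have : ∀ i ∈ Finset.Icc 1 m, (∑ᶠ (_ : 1 ≤ i), (∑ a, if i ≤ k a then (1 : ℝ) else 0) ^ 2) =
        ∑ x : Fin N × Fin N, if i ≤ min (k x.1) (k x.2) then (1 : ℝ) else 0 := by
      intro i hi
      rw [finsum_eq_if, if_pos (Finset.mem_Icc.1 hi).1, sq, Finset.sum_mul_sum,
        Fintype.sum_prod_type]
      refine Finset.sum_congr rfl fun a _ => Finset.sum_congr rfl fun b _ => ?_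
      by_cases h1 : i ≤ k a <;> by_cases h2 : i ≤ k b <;> simp [h1, h2]
    rw [Finset.sum_congr rfl this, Finset.sum_comm, Int.cast_sum]
    exact Finset.sum_congr rfl fun x _ => sum_Icc_ite_le ((min_le_left _ _).trans (hm _))
  · intro i hi
    by_contra hcon
    refine hi ?_
    beta_reduce
    rw [finsum_eq_if]
    split_ifs with h
    · rw [Finset.sum_eq_zero, zero_pow two_ne_zero]
      intro a _
      rw [if_neg]
      intro h'
      exact hcon (by simpa using ⟨h, h'.trans (hm a)⟩)
    · rfl

/-- The exponents of the two formulas for the law of the singular numbers agree. -/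
lemma exponent_eq (k : Fin N → ℤ) (s : ℝ) :
    -(s + 2 * (N : ℝ)) * (∑ j with 0 < k j, (k j : ℝ)) +
        ((∑ x : Fin N × Fin N, max (k x.1) (k x.2) : ℤ) : ℝ) =
      -(s * (∑ j with 0 < k j, (k j : ℝ)) +
        ((∑ x : Fin N × Fin N, max 0 (min (k x.1) (k x.2)) : ℤ) : ℝ) +
        ((∑ x : Fin N × Fin N, max 0 (min (-k x.1) (-k x.2)) : ℤ) : ℝ)) := by
  have h1 : (∑ j with 0 < k j, (k j : ℝ)) = ((∑ j, max 0 (k j) : ℤ) : ℝ) := by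
    rw [Finset.sum_filter, Int.cast_sum]
    refine Finset.sum_congr rfl fun j _ => ?_
    split_ifs with h
    · rw [max_eq_right h.le]
    · rw [max_eq_left (not_lt.1 h), Int.cast_zero]
  have h2 : 2 * (N : ℤ) * ∑ j, max 0 (k j) =
      ∑ x : Fin N × Fin N, (max 0 (k x.1) + max 0 (k x.2)) := by
    rw [Finset.sum_add_distrib, Fintype.sum_prod_type, Fintype.sum_prod_type]
    simp [Finset.mul_sum]
    rw [← Finset.sum_add_distrib]
    exact Finset.sum_congr rfl fun _ _ => by ring
  -- For each pair, `a⁺ + b⁺ = max(a, b) + min(a, b)⁺ + min(-a, -b)⁺`, by cases on the signs.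
  have h3 : 2 * (N : ℤ) * ∑ j, max 0 (k j) = ∑ x : Fin N × Fin N, max (k x.1) (k x.2) +
      ∑ x : Fin N × Fin N, max 0 (min (k x.1) (k x.2)) +
      ∑ x : Fin N × Fin N, max 0 (min (-k x.1) (-k x.2)) := by
    rw [h2, ← Finset.sum_add_distrib, ← Finset.sum_add_distrib]
    exact Finset.sum_congr rfl fun x _ => by omega
  have h4 : 2 * (N : ℝ) * ((∑ j, max 0 (k j) : ℤ) : ℝ) =
      ((∑ x : Fin N × Fin N, max (k x.1) (k x.2) : ℤ) : ℝ) +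
      ((∑ x : Fin N × Fin N, max 0 (min (k x.1) (k x.2)) : ℤ) : ℝ) +
      ((∑ x : Fin N × Fin N, max 0 (min (-k x.1) (-k x.2)) : ℤ) : ℝ) := by exact_mod_cast h3
  rw [h1]
  linear_combination -h4

/-! ### The law of the singular numbers -/

lemma gammaFn_of_sing_eq {k : Fin N → ℤ} {hk : Antitone k} {Z : Matrix (Fin N) (Fin N) ℚ_[p]}
    (h : sing p Z = Delta.ofInt k hk) :
    gammaFn p Z = (p : ℝ) ^ (∑ j with 0 < k j, (k j : ℝ)) := by
  have hp : 0 < (p : ℝ) := by exact_mod_cast (Fact.out : p.Prime).pos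
  rw [Real.rpow_sum_of_pos hp, gammaFn, h]
  refine Finset.prod_congr ?_ fun j _ => ?_
  · ext j
    simp only [Finset.mem_filter, Finset.mem_univ, true_and]
    exact WithBot.coe_lt_coe
  · rw [Real.rpow_intCast]
    rfl

/-- The mass of a tuple of finite singular numbers. -/
theorem singularLaw_singleton (k : Fin N → ℤ) (hk : Antitone k) (s : ℝ) :
    singularLaw p N s {Delta.ofInt k hk} = ENNReal.ofReal
      (huaConst p N s *
        (p : ℝ) ^ (-(s + 2 * (N : ℝ)) * (∑ j with 0 < k j, (k j : ℝ)) +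
          ((∑ x : Fin N × Fin N, max (k x.1) (k x.2) : ℤ) : ℝ)) *
        (qPochhammer (p : ℝ)⁻¹ (p : ℝ)⁻¹ N ^ 2 /
          ∏ᶠ i : WithBot ℤ, qPochhammer (p : ℝ)⁻¹ (p : ℝ)⁻¹ ((Delta.ofInt k hk).mult i))) := by
  have hp : 0 < (p : ℝ) := by exact_mod_cast (Fact.out : p.Prime).pos
  have hpre := preimage_sing_singleton (p := p) (Delta.ofInt k hk)
  have hcomp : IsCompact (sing p ⁻¹' {Delta.ofInt k hk}) := hpre ▸ isCompact_orbit _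
  have hvol := vol_orbit_diagMat (p := p) k
  -- On the fibre the density is constant. Merging the two `ofReal` factors needs only the volume to
  -- be nonnegative, so the sign of `huaConst` plays no role.
  rw [singularLaw, Measure.map_apply measurable_sing (MeasurableSpace.measurableSet_top),
    huaMeasure, withDensity_apply _ hcomp.measurableSet,
    setLIntegral_congr_fun hcomp.measurableSet (g := fun _ => ENNReal.ofReal (huaConst p N s *
      (p : ℝ) ^ (-(s + 2 * (N : ℝ)) * (∑ j with 0 < k j, (k j : ℝ))))),
    setLIntegral_const, ← ENNReal.ofReal_toReal hcomp.measure_lt_top.ne, hpre,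
    ← ENNReal.ofReal_mul' ENNReal.toReal_nonneg]
  · change ENNReal.ofReal (_ * (vol p N (orbit (diagMat p fun j => (k j : WithBot ℤ)))).toReal) = _
    rw [hvol, Real.rpow_add hp, Real.rpow_intCast]
    congr 1
    simp only [mul_assoc]
    rfl
  · intro Z hZ
    simp only
    rw [gammaFn_of_sing_eq hZ, ← Real.rpow_mul hp.le]
    congr 3
    ring

theorem singularLaw_bot (s : ℝ) : singularLaw p N s {k | ∃ j, k.1 j = ⊥} = 0 := by
  rw [singularLaw, Measure.map_apply measurable_sing (MeasurableSpace.measurableSet_top)]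
  refine withDensity_absolutelyContinuous _ _ (measure_mono_null ?_ vol_det_eq_zero)
  rintro Z ⟨j, hj⟩
  obtain ⟨B, C, h⟩ := (isSingularNumbers_iff Z _).1 (isSingularNumbers_sing Z)
  change Z.det = 0
  rw [h, Matrix.det_mul, Matrix.det_mul, diagMat, Matrix.det_diagonal,
    Finset.prod_eq_zero (Finset.mem_univ j) (by rw [hj]; rfl)]
  simp

lemma mult_ofInt (k : Fin N → ℤ) (hk : Antitone k) (j : ℤ) :
    (Delta.ofInt k hk).mult j = (Finset.univ.filter fun a => k a = j).card := by
  rw [Delta.mult]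
  congr 1
  ext a
  simp only [Finset.mem_filter, Finset.mem_univ, true_and]
  exact WithBot.coe_inj

/-- The exponent in terms of the multiplicities. -/
lemma multiplicity_exponent_eq (k : Fin N → ℤ) (hk : Antitone k) (s : ℝ) :
    s * (∑ᶠ (j : ℤ) (_ : 0 ≤ j), (j : ℝ) * ((Delta.ofInt k hk).mult j : ℝ)) +
        (∑ᶠ (i : ℤ) (_ : 1 ≤ i),
          (∑ᶠ (j : ℤ) (_ : i ≤ j), ((Delta.ofInt k hk).mult j : ℝ)) ^ 2) +
        (∑ᶠ (i : ℤ) (_ : 1 ≤ i),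
          (∑ᶠ (j : ℤ) (_ : j ≤ -i), ((Delta.ofInt k hk).mult j : ℝ)) ^ 2) =
      s * (∑ j with 0 < k j, (k j : ℝ)) +
        ((∑ x : Fin N × Fin N, max 0 (min (k x.1) (k x.2)) : ℤ) : ℝ) +
        ((∑ x : Fin N × Fin N, max 0 (min (-k x.1) (-k x.2)) : ℤ) : ℝ) := by
  have h1 : (∑ᶠ (j : ℤ) (_ : 0 ≤ j), (j : ℝ) * ((Delta.ofInt k hk).mult j : ℝ)) =
      ∑ j with 0 < k j, (k j : ℝ) := by
    simp only [mult_ofInt]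
    rw [finsum_mult k (fun j => 0 ≤ j) (fun j => (j : ℝ)), Finset.sum_filter]
    refine Finset.sum_congr rfl fun j _ => ?_
    rcases lt_trichotomy 0 (k j) with h | h | h
    · rw [if_pos h.le, if_pos h]
    -- The index `0` is allowed on the left and not on the right, but its weight is zero.
    · simp [← h]
    · rw [if_neg h.not_ge, if_neg h.not_gt]
  have h2 : ∀ i : ℤ, (∑ᶠ (j : ℤ) (_ : i ≤ j), ((Delta.ofInt k hk).mult j : ℝ)) =
      ∑ a, if i ≤ k a then (1 : ℝ) else 0 := fun i => by
    simpa [mult_ofInt] using finsum_mult k (fun j => i ≤ j) (fun _ => 1)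
  have h3 : ∀ i : ℤ, (∑ᶠ (j : ℤ) (_ : j ≤ -i), ((Delta.ofInt k hk).mult j : ℝ)) =
      ∑ a, if i ≤ -k a then (1 : ℝ) else 0 := fun i => by
    have := finsum_mult k (fun j => j ≤ -i) (fun _ => 1)
    simp only [le_neg (a := k _)] at this
    simpa [mult_ofInt] using this
  simp only [h1, h2, h3]
  rw [finsum_sq_card_ge, finsum_sq_card_ge (fun a => -k a)]

end PadicHua

end

open PadicHua in
theorem proposition3p1 (p : ℕ) [Fact p.Prime] (N : ℕ) (hN : 1 ≤ N) (s : ℝ) (hs : -1 < s) :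
    -- the singular numbers are well defined, and `Sing_N` is a Borel map
    (∀ Z : Matrix (Fin N) (Fin N) ℚ_[p], ∃! k : Delta N, IsSingularNumbers p Z k) ∧
    Measurable (sing p : Matrix (Fin N) (Fin N) ℚ_[p] → Delta N) ∧
    -- the formula in terms of the `k_j` and the `l_i`
    (∀ (k : Fin N → ℤ) (hk : Antitone k),
      singularLaw p N s {Delta.ofInt k hk} = ENNReal.ofReal
        (qPochhammer ((p : ℝ) ^ (-1 - s)) (p : ℝ)⁻¹ N ^ 2 /
            qPochhammer ((p : ℝ) ^ (-1 - s)) (p : ℝ)⁻¹ (2 * N) *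
          (p : ℝ) ^ (-(s + 2 * (N : ℝ)) * (∑ j with 0 < k j, (k j : ℝ)) -
            ∑ j : Fin N, (2 * ((j : ℝ) + 1) - 2 * (N : ℝ) - 1) * (k j : ℝ)) *
          (qPochhammer (p : ℝ)⁻¹ (p : ℝ)⁻¹ N ^ 2 /
            ∏ᶠ i : WithBot ℤ, qPochhammer (p : ℝ)⁻¹ (p : ℝ)⁻¹ ((Delta.ofInt k hk).mult i)))) ∧
    -- the formula in terms of the `l_i` alone
    (∀ (k : Fin N → ℤ) (hk : Antitone k) (l : WithBot ℤ → ℕ), l = (Delta.ofInt k hk).mult →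
      singularLaw p N s {Delta.ofInt k hk} = ENNReal.ofReal
        (qPochhammer ((p : ℝ) ^ (-1 - s)) (p : ℝ)⁻¹ N ^ 2 *
            qPochhammer (p : ℝ)⁻¹ (p : ℝ)⁻¹ N ^ 2 /
            qPochhammer ((p : ℝ) ^ (-1 - s)) (p : ℝ)⁻¹ (2 * N) *
          (p : ℝ) ^ (-(s * (∑ᶠ (j : ℤ) (_ : 0 ≤ j), (j : ℝ) * (l j : ℝ)) +
            (∑ᶠ (i : ℤ) (_ : 1 ≤ i), (∑ᶠ (j : ℤ) (_ : i ≤ j), (l j : ℝ)) ^ 2) +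
            (∑ᶠ (i : ℤ) (_ : 1 ≤ i), (∑ᶠ (j : ℤ) (_ : j ≤ -i), (l j : ℝ)) ^ 2))) *
          (1 / ∏ᶠ i : WithBot ℤ, qPochhammer (p : ℝ)⁻¹ (p : ℝ)⁻¹ (l i)))) ∧
    -- tuples with an entry `-∞` carry no mass
    singularLaw p N s {k | ∃ j, k.1 j = ⊥} = 0 := by
  refine ⟨fun Z => ?_, measurable_sing, fun k hk => ?_, fun k hk l hl => ?_, singularLaw_bot s⟩
  · exact ⟨sing p Z, isSingularNumbers_sing Z, fun k hk => hk.unique (isSingularNumbers_sing Z)⟩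
  · rw [singularLaw_singleton, sum_max_eq k hk, ← sub_eq_add_neg, huaConst]
  · subst hl
    rw [singularLaw_singleton, exponent_eq, multiplicity_exponent_eq, huaConst]
    congr 1
    ring
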